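/- Let $m\ge 0$ be an integer and let $a_n$ be the coefficient of $q^n$ in the power series $$\prod_{k=1}^{\infty}\left(\frac{1+q^k}{1-q^k}\right)^{k^m}=\sum_{n\ge 0}a_nq^n .$$ Then, as $n\to\infty$, $$a_n\sim\frac{1}{\sqrt{(m+2)\pi n}}\left(\frac{(2^{m+2}-1)\,\Gamma(m+2)\,\zeta(m+2)}{2^{2m+3}\,n}\right)^{\frac{1-2\zeta(-m)}{2m+4}}\exp\left(\frac{m+2}{m+1}\left(\frac{(2^{m+2}-1)\,n^{m+1}\,\Gamma(m+2)\,\zeta(m+2)}{2^{m+1}}\right)^{\frac1{m+2}}+\zeta'(-m)\right),$$ where $\zeta$ is the Riemann zeta function (analytically continued), $\zeta'$ its derivative and $\Gamma$ the Gamma function. If moreover $m$ is even and $m\ge 2$, then $$a_n\sim\frac{1}{\sqrt{(m+2)\pi n}}\left(\frac{(2^{m+2}-1)\,\Gamma(m+2)\,\zeta(m+2)}{2^{2m+3}\,n}\right)^{\frac{1}{2m+4}}\exp\left(\frac{m+2}{m+1}\left(\frac{(2^{m+2}-1)\,n^{m+1}\,\Gamma(m+2)\,\zeta(m+2)}{2^{m+1}}\right)^{\frac1{m+2}}+(-1)^{m/2}\,\frac{\Gamma(m+1)\,\zeta(m+1)}{2^{m+1}\pi^m}\right).$$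 -/

import Mathlib

open Filter Asymptotics

/-- The values of the Riemann zeta function at real arguments (they are real, see
`ofReal_zetaReal`). -/
noncomputable def zetaReal (x : ℝ) : ℝ := (riemannZeta (x : ℂ)).re

/-- The values of the derivative `ζ'` of the Riemann zeta function at real arguments. -/
noncomputable def zetaDerivReal (x : ℝ) : ℝ := (deriv riemannZeta (x : ℂ)).re

/-- Taking real parts loses nothing: `ζ` is real on the real line. -/
theorem ofReal_zetaReal (x : ℝ) : ((zetaReal x : ℝ) : ℂ) = riemannZeta (x : ℂ) := by
  have h := riemannZeta_conj (x : ℂ)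
  rw [Complex.conj_ofReal] at h
  exact Complex.conj_eq_iff_re.mp h.symm

/-- Taking real parts loses nothing: `ζ'` is real on the real line (away from the pole). -/
theorem hasDerivAt_zetaReal (x : ℝ) (hx : x ≠ 1) :
    HasDerivAt zetaReal (zetaDerivReal x) x :=
  (differentiableAt_riemannZeta
    (by exact_mod_cast hx : (x : ℂ) ≠ 1)).hasDerivAt.real_of_complex

/-- The factor `((1 + q^k) / (1 - q^k))^(k^m)` with `k = i + 1`, as a formal power series in `q`. -/
noncomputable def ratioFactor (m i : ℕ) : PowerSeries ℝ :=
  ((1 + PowerSeries.X ^ (i + 1)) * (1 - PowerSeries.X ^ (i + 1))⁻¹) ^ ((i + 1) ^ m)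

section

open scoped PowerSeries.WithPiTopology

/-- The infinite product of the factors converges coefficientwise, so that `ratioSeries` is
the genuine product. -/
theorem multipliable_ratioFactor (m : ℕ) : Multipliable (ratioFactor m) := by
  have key : ∀ i : ℕ, (PowerSeries.X : PowerSeries ℝ) ^ (i + 1) ∣ ratioFactor m i - 1 := by
    intro i
    have h0 : PowerSeries.constantCoeff (1 - (PowerSeries.X : PowerSeries ℝ) ^ (i + 1)) ≠ 0 := by
      simp
    have h1 := PowerSeries.mul_inv_cancel _ h0
    have h2 : (PowerSeries.X : PowerSeries ℝ) ^ (i + 1) ∣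
        (1 + PowerSeries.X ^ (i + 1)) * (1 - PowerSeries.X ^ (i + 1))⁻¹ - 1 := by
      refine ⟨2 * (1 - PowerSeries.X ^ (i + 1))⁻¹, ?_⟩
      linear_combination h1
    refine h2.trans ?_
    simpa [ratioFactor] using sub_dvd_pow_sub_pow
      ((1 + (PowerSeries.X : PowerSeries ℝ) ^ (i + 1)) * (1 - PowerSeries.X ^ (i + 1))⁻¹) 1
      ((i + 1) ^ m)
  have h : Tendsto (fun i => (ratioFactor m i - 1).order) atTop (nhds ⊤) := by
    refine ENat.tendsto_nhds_top_iff_natCast_lt.mpr fun n =>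
      eventually_atTop.mpr ⟨n, fun i hi => ?_⟩
    have h3 := PowerSeries.X_pow_dvd_iff.mp (key i)
    refine lt_of_lt_of_le ?_ (PowerSeries.nat_le_order _ (i + 1) h3)
    exact_mod_cast Nat.lt_succ_of_le hi
  simpa using PowerSeries.WithPiTopology.multipliable_one_add_of_tendsto_order_atTop_nhds_top ℝ h

/-- The formal power series `∏_{k ≥ 1} ((1 + q^k) / (1 - q^k))^(k^m)`, the infinite product being
taken in the topology of coefficientwise convergence. -/
noncomputable def ratioSeries (m : ℕ) : PowerSeries ℝ := ∏' i : ℕ, ratioFactor m i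

end

/-- The coefficient of `q^n` in `∏_{k ≥ 1} ((1 + q^k) / (1 - q^k))^(k^m)`. -/
noncomputable def ratioCoeff (m n : ℕ) : ℝ := PowerSeries.coeff n (ratioSeries m)

/-!
The generating function is analysed at `q = e^{-z}`, `z = x + i y`, by the saddle point method.
Its logarithm is the double series
`logGen m z = ∑ 2 k^m / j * e^{-k j z}` over `k ≥ 1` and odd `j ≥ 1`, and Cauchy's formula
(`integral_exp_logGen`) writes `2 π a_n` as the integral of `exp (logGen m z + n z)` over
`-π ≤ y ≤ π`.

Expansion at `z = 0`. Summing over `k` first gives `∑ 2 / j * h (j z)` with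
`h w = ∑ k^m e^{-k w} = m! / w^(m+1) + r w`, where `r = polyRemainder m` is, up to sign, the `m`-th
derivative of `1 / (e^w - 1) - 1 / w`; in particular `r` is analytic at `0` and Cauchy's estimates
control it and its derivatives in a sector around the positive axis. The polar parts add up to
`A / z^(m+1)`, with `A = leadCoeff m`. The rest, `logRemainder m z = ∑ 2 / j * r (j z)`, varies by
`O(|y| / x)` when `z` moves off the real axis (`exists_norm_logRemainder_sub_le`), and for `z = x`
real it is, up to `o(1)`, `-r 0 * log (x / 2)` plus a midpoint sum for the integral of
`(r t - r 0 e^{-t}) / t` over `t > 0` (`tendsto_logRemainder`). The Mellin transform of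
`r t - r 0 e^{-t}` continues `Γ(s) (ζ(s - m) - r 0)` to `Re s > -1`; regularity at `s = 0` forces `r 0 = ζ(-m)`
(`polyRemainder_zero`), and the value there is `ζ'(-m)` (`mellin_parts_zero`). No growth
estimate for the zeta function in vertical strips is needed.

Integration. For `2 π x ≤ |y| ≤ π` the terms with `j = 1` and `N ≤ k < 2 N`, where
`N = ⌈1 / x⌉`, alone make the integrand exponentially smaller than at `y = 0` (`re_logGen_le_of_minor`). For `|y| ≤ 2 π x`
the expansion applies, and Laplace's method (`tendsto_integral_saddleIntegrand`) gives a Gaussian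
integral as `x → 0`. The saddle point is `x = ((m + 1) A / n)^(1 / (m + 2))`, and
`predicted_eq` rewrites the main term in terms of it. For even `m ≥ 2` the zeta values are made
explicit by `ζ(-m) = 0` and by differentiating the functional equation at `s = m + 1`.
-/

/-! ### Power series and their sums on the unit disc -/

/-- `HasDiscSum p g`: the real power series `p` converges to `g` on the open complex unit disc. -/
def HasDiscSum (p : PowerSeries ℝ) (g : ℂ → ℂ) : Prop :=
  ∀ q : ℂ, ‖q‖ < 1 → HasSum (fun n : ℕ => ((PowerSeries.coeff n p : ℝ) : ℂ) * q ^ n) (g q)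

theorem HasDiscSum.mul {p₁ p₂ : PowerSeries ℝ} {g₁ g₂ : ℂ → ℂ} (h₁ : HasDiscSum p₁ g₁)
    (h₂ : HasDiscSum p₂ g₂) : HasDiscSum (p₁ * p₂) (fun q => g₁ q * g₂ q) := by
  intro q hq
  have s₁ := (h₁ q hq).summable.norm
  have s₂ := (h₂ q hq).summable.norm
  have e := tsum_mul_tsum_eq_tsum_sum_antidiagonal_of_summable_norm s₁ s₂
  have s := (summable_norm_sum_mul_antidiagonal_of_summable_norm s₁ s₂).of_norm
  rw [(h₁ q hq).tsum_eq, (h₂ q hq).tsum_eq] at e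
  change HasSum _ (g₁ q * g₂ q)
  rw [e]
  convert! s.hasSum using 2 with n
  rw [PowerSeries.coeff_mul]
  push_cast
  rw [Finset.sum_mul]
  refine Finset.sum_congr rfl fun x hx => ?_
  rw [← Finset.HasAntidiagonal.mem_antidiagonal.mp hx, pow_add]
  ring

theorem hasDiscSum_one : HasDiscSum 1 (fun _ => 1) := by
  intro q _
  convert! hasSum_ite_eq (0 : ℕ) (1 : ℂ) using 2 with n
  by_cases h : n = 0 <;> simp [h, PowerSeries.coeff_one]

theorem HasDiscSum.pow {p : PowerSeries ℝ} {g : ℂ → ℂ} (h : HasDiscSum p g) (k : ℕ) :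
    HasDiscSum (p ^ k) (fun q => g q ^ k) := by
  induction k with
  | zero => simpa using hasDiscSum_one
  | succ k ih => simpa only [pow_succ] using ih.mul h

theorem HasDiscSum.prod {p : ℕ → PowerSeries ℝ} {g : ℕ → ℂ → ℂ}
    (h : ∀ i, HasDiscSum (p i) (g i)) (s : Finset ℕ) :
    HasDiscSum (∏ i ∈ s, p i) (fun q => ∏ i ∈ s, g i q) := by
  induction s using Finset.cons_induction with
  | empty => simpa using hasDiscSum_one
  | cons a s ha ih => simpa only [Finset.prod_cons] using (h a).mul ih

theorem hasDiscSum_one_add_X_pow (i : ℕ) :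
    HasDiscSum (1 + PowerSeries.X ^ (i + 1)) (fun q => 1 + q ^ (i + 1)) := by
  intro q hq
  convert! (hasDiscSum_one q hq).add (hasSum_ite_eq (i + 1) (q ^ (i + 1))) using 2 with n
  rw [map_add, PowerSeries.coeff_X_pow]
  by_cases h : n = i + 1 <;> simp [h, PowerSeries.coeff_one]

theorem hasDiscSum_inv_one_sub_X_pow (i : ℕ) :
    HasDiscSum (1 - PowerSeries.X ^ (i + 1))⁻¹ (fun q => (1 - q ^ (i + 1))⁻¹) := by
  have e : (1 - (PowerSeries.X : PowerSeries ℝ) ^ (i + 1))⁻¹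
      = PowerSeries.mk fun n => if i + 1 ∣ n then 1 else 0 := by
    symm
    rw [PowerSeries.eq_inv_iff_mul_eq_one (by simp)]
    ext n
    rw [mul_sub, mul_one, map_sub, PowerSeries.coeff_mk, PowerSeries.coeff_mul_X_pow',
      PowerSeries.coeff_one]
    rcases Nat.lt_or_ge n (i + 1) with h | h
    · rcases Nat.eq_zero_or_pos n with h0 | h0
      · simp [h0]
      · simp [Nat.not_le.mpr h, h0.ne', Nat.not_dvd_of_pos_of_lt h0 h]
    · obtain ⟨d, rfl⟩ := Nat.exists_eq_add_of_le h
      simp [PowerSeries.coeff_mk]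
  intro q hq
  have hg := hasSum_geometric_of_norm_lt_one
    (show ‖q ^ (i + 1)‖ < 1 by rw [norm_pow]; exact pow_lt_one₀ (norm_nonneg _) hq (by omega))
  -- The sum over all exponents is the sum over the multiples of `i + 1`, a geometric series.
  have inj : Function.Injective (fun n : ℕ => (i + 1) * n) :=
    fun a b h => Nat.eq_of_mul_eq_mul_left (by omega) h
  rw [e, ← inj.hasSum_iff]
  · convert! hg using 2 with n
    simp [pow_mul]
  · intro n hn
    have : ¬ (i + 1 ∣ n) := fun ⟨k, hk⟩ => hn ⟨k, hk.symm⟩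
    simp [this]

theorem hasDiscSum_ratioFactor (m i : ℕ) : HasDiscSum (ratioFactor m i)
    (fun q => ((1 + q ^ (i + 1)) * (1 - q ^ (i + 1))⁻¹) ^ ((i + 1) ^ m)) :=
  ((hasDiscSum_one_add_X_pow i).mul (hasDiscSum_inv_one_sub_X_pow i)).pow _

theorem integral_exp_int_mul_I (k : ℤ) :
    ∫ y in (-Real.pi)..Real.pi, Complex.exp ((k : ℂ) * (y : ℂ) * Complex.I)
      = if k = 0 then ((2 * Real.pi : ℝ) : ℂ) else 0 := by
  split_ifs with h
  · simp [h]; ring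
  · have hc : (k : ℂ) * Complex.I ≠ 0 := by simp [h]
    have := integral_exp_mul_complex (a := -Real.pi) (b := Real.pi) hc
    simp_rw [mul_right_comm (k : ℂ) _ Complex.I]
    rw [this]
    have : Complex.exp ((k : ℂ) * Complex.I * (Real.pi : ℂ))
        = Complex.exp ((k : ℂ) * Complex.I * ((-Real.pi : ℝ) : ℂ)) := by
      rw [Complex.exp_eq_exp_iff_exists_int]
      exact ⟨k, by push_cast; ring⟩
    rw [this]; simp

/-- Cauchy's formula for the Taylor coefficients, in the coordinate `z` with `q = e^{-z}`. -/
theorem HasDiscSum.integral_eq {p : PowerSeries ℝ} {g : ℂ → ℂ} (h : HasDiscSum p g) (n : ℕ)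
    {x : ℝ} (hx : 0 < x) :
    ∫ y in (-Real.pi)..Real.pi, g (Complex.exp (-(x + y * Complex.I)))
        * Complex.exp (n * (x + y * Complex.I))
      = ((2 * Real.pi : ℝ) : ℂ) * ((PowerSeries.coeff n p : ℝ) : ℂ) := by
  have hq : ‖(Real.exp (-x) : ℂ)‖ < 1 := by
    rw [Complex.norm_real, Real.norm_eq_abs, abs_of_pos (Real.exp_pos _)]; simpa using hx
  have hS := ((h _ hq).summable.norm).mul_right (Real.exp (n * x))
  have key := intervalIntegral.hasSum_intervalIntegral_of_summable_norm
    (a := -Real.pi) (b := Real.pi)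
    (f := fun k : ℕ => ⟨fun y : ℝ => ((PowerSeries.coeff k p : ℝ) : ℂ)
      * Complex.exp (-(x + y * Complex.I)) ^ k * Complex.exp (n * (x + y * Complex.I)),
        by fun_prop⟩) ?_
  · simp only [ContinuousMap.coe_mk] at key
    have e1 : ∀ y : ℝ, ∑' k : ℕ, ((PowerSeries.coeff k p : ℝ) : ℂ)
        * Complex.exp (-(x + y * Complex.I)) ^ k * Complex.exp (n * (x + y * Complex.I))
        = g (Complex.exp (-(x + y * Complex.I))) * Complex.exp (n * (x + y * Complex.I)) := by
      intro y
      have := (h (Complex.exp (-(x + y * Complex.I)))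
        (by rw [Complex.norm_exp]; simpa using hx)).mul_right (Complex.exp (n * (x + y * Complex.I)))
      exact this.tsum_eq
    simp_rw [e1] at key
    refine key.unique ?_
    convert! hasSum_ite_eq n (((2 * Real.pi : ℝ) : ℂ) * ((PowerSeries.coeff n p : ℝ) : ℂ)) using 2 with k
    have e2 : ∀ y : ℝ, ((PowerSeries.coeff k p : ℝ) : ℂ)
        * Complex.exp (-(x + y * Complex.I)) ^ k * Complex.exp (n * (x + y * Complex.I))
        = ((PowerSeries.coeff k p : ℝ) : ℂ) * Complex.exp (((n : ℂ) - k) * x) *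
          Complex.exp ((((n : ℤ) - k : ℤ) : ℂ) * y * Complex.I) := by
      intro y
      rw [← Complex.exp_nat_mul, mul_assoc, mul_assoc, ← Complex.exp_add, ← Complex.exp_add]
      congr 2; push_cast; ring
    simp_rw [e2]
    rw [intervalIntegral.integral_const_mul, integral_exp_int_mul_I]
    by_cases hk : k = n
    · subst hk; simp; ring
    · have : ((n : ℤ) - k) ≠ 0 := by omega
      rw [if_neg this, if_neg hk, mul_zero]
  · refine Summable.of_nonneg_of_le (fun _ => norm_nonneg _) (fun k => ?_) hS
    refine (ContinuousMap.norm_le _ (by positivity)).mpr fun y => ?_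
    simp only [ContinuousMap.restrict_apply, ContinuousMap.coe_mk, norm_mul, norm_pow,
      Complex.norm_exp, Complex.norm_real]
    simp

/-! ### The logarithm of the generating function -/

/-- The logarithm of `(1 + q) / (1 - q)`. -/
noncomputable def logRatio (q : ℂ) : ℂ := Complex.log (1 + q) - Complex.log (1 - q)

theorem exp_logRatio {q : ℂ} (hq : ‖q‖ < 1) :
    Complex.exp (logRatio q) = (1 + q) * (1 - q)⁻¹ := by
  have h1 : 1 + q ≠ 0 := fun h => by
    have : q = -1 := by linear_combination h
    simp [this] at hq
  have h2 : 1 - q ≠ 0 := fun h => by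
    have : q = 1 := by linear_combination -h
    simp [this] at hq
  rw [logRatio, Complex.exp_sub, Complex.exp_log h1, Complex.exp_log h2, div_eq_mul_inv]

theorem hasSum_logRatio {q : ℂ} (hq : ‖q‖ < 1) :
    HasSum (fun j : ℕ => 2 / (2 * j + 1 : ℂ) * q ^ (2 * j + 1)) (logRatio q) := by
  have h := (Complex.hasSum_taylorSeries_log hq).add (Complex.hasSum_taylorSeries_neg_log hq)
  -- The even terms of the two logarithmic series cancel.
  have inj : Function.Injective (fun n : ℕ => 2 * n + 1) := fun a b h => by
    simp only at h; omega
  rw [logRatio, sub_eq_add_neg]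
  rw [← inj.hasSum_iff] at h
  · convert! h using 2 with j
    simp only [Function.comp]
    have : (-1 : ℂ) ^ (2 * j + 1 + 1) = 1 := by
      rw [show 2 * j + 1 + 1 = 2 * (j + 1) by ring, pow_mul]; simp
    rw [this]; push_cast; ring
  · intro n hn
    have he : Even n := by
      rw [← Nat.not_odd_iff_even]; rintro ⟨k, hk⟩; exact hn ⟨k, hk.symm⟩
    rw [he.add_one.neg_one_pow]; ring

/-- The general term of the double series for the logarithm of the generating function at
`q = e^{-z}`: the index `(k, j)` stands for the integer `k + 1` and the odd integer `2 j + 1`. -/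
noncomputable def logTerm (m : ℕ) (z : ℂ) (p : ℕ × ℕ) : ℂ :=
  2 * (p.1 + 1) ^ m / (2 * p.2 + 1) * Complex.exp (-((p.1 + 1) * (2 * p.2 + 1) * z))

/-- The logarithm of the generating function at `q = e^{-z}`, where `Re z > 0`. -/
noncomputable def logGen (m : ℕ) (z : ℂ) : ℂ := ∑' p : ℕ × ℕ, logTerm m z p

theorem norm_logTerm (m : ℕ) (z : ℂ) (p : ℕ × ℕ) :
    ‖logTerm m z p‖ = 2 * (p.1 + 1) ^ m / (2 * p.2 + 1)
      * Real.exp (-((p.1 + 1) * (2 * p.2 + 1) * z.re)) := by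
  have e : logTerm m z p = ((2 * (p.1 + 1) ^ m / (2 * p.2 + 1) : ℝ) : ℂ)
      * Complex.exp (-(((p.1 + 1) * (2 * p.2 + 1) : ℝ) * z)) := by
    rw [logTerm]; push_cast; rfl
  rw [e, norm_mul, Complex.norm_exp, Complex.norm_real, Real.norm_of_nonneg (by positivity)]
  congr 2
  rw [Complex.neg_re, Complex.re_ofReal_mul]

theorem summable_succ_pow_mul_exp (m : ℕ) {x : ℝ} (hx : 0 < x) :
    Summable fun k : ℕ => ((k : ℝ) + 1) ^ m * Real.exp (-((k + 1) * x)) := by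
  have h := Real.summable_pow_mul_exp_neg_nat_mul m hx
  have := (summable_nat_add_iff 1).mpr h
  refine this.congr fun k => ?_
  push_cast
  congr 2; ring

theorem summable_norm_logTerm (m : ℕ) {z : ℂ} (hz : 0 < z.re) :
    Summable fun p => ‖logTerm m z p‖ := by
  have h1 := (summable_succ_pow_mul_exp m hz).mul_left 2
  have h2 : Summable fun j : ℕ => Real.exp (-(2 * z.re)) ^ j :=
    summable_geometric_of_lt_one (Real.exp_pos _).le (by simpa using hz)
  -- `(k + 1) (2 j + 1) ≥ (k + 1) + 2 j` separates the two summation indices.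
  refine Summable.of_nonneg_of_le (fun _ => norm_nonneg _) (fun p => ?_)
    (h1.mul_of_nonneg h2 (fun k => by positivity) (fun j => by positivity))
  rw [norm_logTerm, ← Real.exp_nat_mul, mul_assoc 2, mul_assoc ((_ : ℝ) ^ m), ← Real.exp_add,
    ← mul_assoc]
  refine mul_le_mul (div_le_self (by positivity) (by linarith [p.2.cast_nonneg (α := ℝ)]))
    (Real.exp_le_exp.mpr ?_) (Real.exp_pos _).le (by positivity)
  nlinarith [mul_nonneg (mul_nonneg p.1.cast_nonneg (p.2.cast_nonneg (α := ℝ))) hz.le]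

theorem norm_exp_neg_mul_lt_one {z : ℂ} (hz : 0 < z.re) (k : ℕ) :
    ‖Complex.exp (-z) ^ (k + 1)‖ < 1 := by
  rw [norm_pow, Complex.norm_exp]
  exact pow_lt_one₀ (Real.exp_pos _).le (by simpa using hz) (by omega)

theorem hasSum_logTerm_snd (m : ℕ) {z : ℂ} (hz : 0 < z.re) (k : ℕ) :
    HasSum (fun j => logTerm m z (k, j))
      ((k + 1 : ℂ) ^ m * logRatio (Complex.exp (-z) ^ (k + 1))) := by
  convert! (hasSum_logRatio (norm_exp_neg_mul_lt_one hz k)).mul_left ((k + 1 : ℂ) ^ m) using 2 with j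
  rw [logTerm, ← pow_mul, ← Complex.exp_nat_mul]
  push_cast
  rw [show -(((k : ℂ) + 1) * (2 * j + 1) * z) = (k + 1) * (2 * j + 1) * -z by ring]
  ring

theorem hasSum_logGen (m : ℕ) {z : ℂ} (hz : 0 < z.re) :
    HasSum (fun k : ℕ => (k + 1 : ℂ) ^ m * logRatio (Complex.exp (-z) ^ (k + 1))) (logGen m z) :=
  (summable_norm_logTerm m hz).of_norm.hasSum.prod_fiberwise fun k => hasSum_logTerm_snd m hz k

theorem prod_eq_exp_sum_logRatio (m N : ℕ) {z : ℂ} (hz : 0 < z.re) :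
    ∏ i ∈ Finset.range N, ((1 + Complex.exp (-z) ^ (i + 1)) *
      (1 - Complex.exp (-z) ^ (i + 1))⁻¹) ^ ((i + 1) ^ m)
      = Complex.exp (∑ k ∈ Finset.range N,
          (k + 1 : ℂ) ^ m * logRatio (Complex.exp (-z) ^ (k + 1))) := by
  rw [Complex.exp_sum]
  refine Finset.prod_congr rfl fun k _ => ?_
  rw [← exp_logRatio (norm_exp_neg_mul_lt_one hz k), ← Complex.exp_nat_mul]
  push_cast; rfl

theorem norm_sum_logRatio_le (m N : ℕ) {z : ℂ} (hz : 0 < z.re) :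
    ‖∑ k ∈ Finset.range N, (k + 1 : ℂ) ^ m * logRatio (Complex.exp (-z) ^ (k + 1))‖
      ≤ ∑' p, ‖logTerm m z p‖ := by
  have hs := summable_norm_logTerm m hz
  have h1 : ∀ k : ℕ, ‖(k + 1 : ℂ) ^ m * logRatio (Complex.exp (-z) ^ (k + 1))‖
      ≤ ∑' j, ‖logTerm m z (k, j)‖ := fun k => by
    rw [← (hasSum_logTerm_snd m hz k).tsum_eq]
    exact norm_tsum_le_tsum_norm (hs.prod_factor k)
  rw [hs.tsum_prod]
  refine (norm_sum_le _ _).trans ((Finset.sum_le_sum fun k _ => h1 k).trans ?_)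
  exact hs.prod.sum_le_tsum _ fun k _ => tsum_nonneg fun j => norm_nonneg _

open scoped PowerSeries.WithPiTopology in
theorem tendsto_coeff_prod_ratioFactor (m n : ℕ) :
    Tendsto (fun N => PowerSeries.coeff n (∏ i ∈ Finset.range N, ratioFactor m i)) atTop
      (nhds (ratioCoeff m n)) :=
  ((PowerSeries.WithPiTopology.continuous_coeff ℝ n).tendsto _).comp
    (multipliable_ratioFactor m).hasProd.tendsto_prod_nat

/-- Cauchy's formula for the coefficients of the infinite product. -/
theorem integral_exp_logGen (m n : ℕ) {x : ℝ} (hx : 0 < x) :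
    ∫ y in (-Real.pi)..Real.pi, Complex.exp (logGen m (x + y * Complex.I))
        * Complex.exp (n * (x + y * Complex.I))
      = ((2 * Real.pi : ℝ) : ℂ) * ratioCoeff m n := by
  have hre : ∀ y : ℝ, ((x : ℂ) + y * Complex.I).re = x := fun y => by simp
  have hz : ∀ y : ℝ, 0 < ((x : ℂ) + y * Complex.I).re := fun y => by rwa [hre]
  -- Both sides are limits of the same quantity for the finite partial products; on the vertical
  -- line these are dominated by the value of the full double series of absolute values.
  have h1 := fun N => ((HasDiscSum.prod (hasDiscSum_ratioFactor m) (Finset.range N)).integral_eq n hx)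
  have h2 : Tendsto (fun N : ℕ => ((2 * Real.pi : ℝ) : ℂ) *
      ((PowerSeries.coeff n (∏ i ∈ Finset.range N, ratioFactor m i) : ℝ) : ℂ)) atTop
      (nhds (((2 * Real.pi : ℝ) : ℂ) * ratioCoeff m n)) :=
    ((Complex.continuous_ofReal.tendsto _).comp (tendsto_coeff_prod_ratioFactor m n)).const_mul _
  refine tendsto_nhds_unique ?_ h2
  simp_rw [← h1]
  refine intervalIntegral.tendsto_integral_filter_of_dominated_convergence
    (fun _ => Real.exp (∑' p, ‖logTerm m x p‖) * Real.exp (n * x)) ?_ ?_ ?_ ?_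
  · refine Eventually.of_forall fun N => Continuous.aestronglyMeasurable ?_
    refine Continuous.mul (continuous_finsetProd _ fun i _ => ?_) (by fun_prop)
    refine Continuous.pow (Continuous.mul (by fun_prop) (Continuous.inv₀ (by fun_prop) ?_)) _
    intro y h
    have h3 := norm_exp_neg_mul_lt_one (hz y) i
    rw [← sub_eq_zero.mp h] at h3
    simp at h3
  · refine Eventually.of_forall fun N => Eventually.of_forall fun y _ => ?_
    rw [norm_mul, prod_eq_exp_sum_logRatio m N (hz y), Complex.norm_exp (_ * _)]
    refine mul_le_mul ?_ (by simp) (Real.exp_pos _).le (Real.exp_pos _).le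
    rw [Complex.norm_exp]
    refine Real.exp_le_exp.mpr ((Complex.re_le_norm _).trans
      ((norm_sum_logRatio_le m N (hz y)).trans (le_of_eq ?_)))
    refine tsum_congr fun p => ?_
    rw [norm_logTerm, norm_logTerm, hre, Complex.ofReal_re]
  · exact intervalIntegrable_const
  · refine Eventually.of_forall fun y _ => Tendsto.mul_const _ ?_
    simp_rw [prod_eq_exp_sum_logRatio m _ (hz y)]
    exact (Complex.continuous_exp.tendsto _).comp (hasSum_logGen m (hz y)).tendsto_sum_nat

/-! ### The function `1 / (e^w - 1) - 1 / w` and its derivatives -/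

/-- The entire function `(e^w - 1) / w`. -/
noncomputable def expQuot : ℂ → ℂ := dslope Complex.exp 0

/-- The function `1 / (e^w - 1) - 1 / w`, extended analytically through `w = 0`. -/
noncomputable def expRemainder (w : ℂ) : ℂ := -dslope expQuot 0 w / expQuot w

theorem differentiable_expQuot : Differentiable ℂ expQuot := by
  rw [← differentiableOn_univ]
  exact (Complex.differentiableOn_dslope univ_mem).mpr Complex.differentiable_exp.differentiableOn

theorem expQuot_zero : expQuot 0 = 1 := by simp [expQuot, dslope_same]

theorem expQuot_of_ne {w : ℂ} (hw : w ≠ 0) : expQuot w = (Complex.exp w - 1) / w := by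
  rw [expQuot, dslope_of_ne _ hw, slope_def_field]; simp

theorem expQuot_ne_zero_of_re_pos {w : ℂ} (hw : 0 < w.re) : expQuot w ≠ 0 := by
  have h0 : w ≠ 0 := fun h => by simp [h] at hw
  rw [expQuot_of_ne h0]
  refine div_ne_zero (fun h => ?_) h0
  have h1 : ‖Complex.exp w‖ = 1 := by rw [sub_eq_zero.mp h]; simp
  rw [Complex.norm_exp, Real.exp_eq_one_iff] at h1
  exact hw.ne' h1

theorem expQuot_ne_zero_of_norm_lt {w : ℂ} (hw : ‖w‖ < 2 * Real.pi) : expQuot w ≠ 0 := by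
  rcases eq_or_ne w 0 with rfl | h0
  · simp [expQuot_zero]
  rw [expQuot_of_ne h0]
  refine div_ne_zero (fun h => ?_) h0
  obtain ⟨n, hn⟩ := Complex.exp_eq_one_iff.mp (sub_eq_zero.mp h)
  have hn0 : n ≠ 0 := by rintro rfl; simp [h0] at hn
  have h1 : (1 : ℝ) ≤ |(n : ℝ)| := by exact_mod_cast Int.one_le_abs hn0
  have h2 : ‖w‖ = |(n : ℝ)| * (2 * Real.pi) := by
    rw [hn]; simp [abs_of_pos Real.pi_pos]
  nlinarith [Real.pi_pos]

theorem isOpen_expQuot_ne_zero : IsOpen {w | expQuot w ≠ 0} :=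
  isOpen_ne_fun differentiable_expQuot.continuous continuous_const

theorem differentiableOn_expRemainder : DifferentiableOn ℂ expRemainder {w | expQuot w ≠ 0} := by
  have h : Differentiable ℂ (dslope expQuot 0) := by
    rw [← differentiableOn_univ]
    exact (Complex.differentiableOn_dslope univ_mem).mpr differentiable_expQuot.differentiableOn
  exact h.neg.differentiableOn.div differentiable_expQuot.differentiableOn fun w hw => hw

theorem expRemainder_of_re_pos {w : ℂ} (hw : 0 < w.re) :
    expRemainder w = (Complex.exp w - 1)⁻¹ - w⁻¹ := by
  have h0 : w ≠ 0 := fun h => by simp [h] at hw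
  have h1 := expQuot_ne_zero_of_re_pos hw
  have h2 : Complex.exp w - 1 ≠ 0 := fun h => h1 (by rw [expQuot_of_ne h0, h, zero_div])
  rw [expRemainder, dslope_of_ne _ h0, slope_def_field, expQuot_zero, expQuot_of_ne h0]
  field_simp
  ring

theorem exists_norm_expRemainder_le : ∃ C : ℝ, 0 ≤ C ∧ ∀ w : ℂ, (‖w‖ ≤ 3 ∨ ‖w‖ ≤ 17 * w.re) →
    ‖expRemainder w‖ ≤ C / (1 + ‖w‖) := by
  -- Near the origin compactness suffices, as `3 < 2 π`; far out in the sector `‖e^w - 1‖ ≥ Re w`.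
  have hsub : Metric.closedBall (0 : ℂ) 3 ⊆ {w | expQuot w ≠ 0} := fun w hw =>
    expQuot_ne_zero_of_norm_lt (by
      have := mem_closedBall_zero_iff.mp hw; linarith [Real.pi_gt_three])
  obtain ⟨C, hC⟩ := (isCompact_closedBall (0 : ℂ) 3).exists_bound_of_continuousOn
    (differentiableOn_expRemainder.continuousOn.mono hsub)
  have hC0 : 0 ≤ C := (norm_nonneg _).trans (hC 0 (by simp))
  refine ⟨4 * C + 36, by positivity, fun w hw => ?_⟩
  rw [le_div_iff₀ (by positivity)]
  rcases le_or_gt ‖w‖ 3 with h | h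
  · have := hC w (by simpa using h)
    nlinarith [norm_nonneg w, norm_nonneg (expRemainder w)]
  · have h' : ‖w‖ ≤ 17 * w.re := hw.resolve_left (not_le.mpr h)
    have hre : 0 < w.re := by linarith
    have h1 : w.re ≤ ‖Complex.exp w - 1‖ := by
      have e1 := norm_sub_norm_le (Complex.exp w) 1
      rw [Complex.norm_exp, norm_one] at e1
      linarith [Real.add_one_le_exp w.re]
    have h2 : ‖expRemainder w‖ ≤ 18 / ‖w‖ := by
      rw [expRemainder_of_re_pos hre]
      refine (norm_sub_le _ _).trans ?_
      rw [norm_inv, norm_inv]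
      have : ‖Complex.exp w - 1‖⁻¹ ≤ 17 / ‖w‖ := by
        rw [inv_le_comm₀ (by linarith) (by positivity), inv_div]
        linarith
      calc _ ≤ 17 / ‖w‖ + ‖w‖⁻¹ := by gcongr
        _ = 18 / ‖w‖ := by ring
    rw [le_div_iff₀ (by linarith)] at h2
    nlinarith [norm_nonneg (expRemainder w)]

/-- The analytic function whose value for `Re w > 0` is `∑ k^m e^{-kw} - m! / w^(m+1)`: the sum
of the series with its polar part at `w = 0` removed. -/
noncomputable def polyRemainder (m : ℕ) (w : ℂ) : ℂ := (-1) ^ m * iteratedDeriv m expRemainder w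

theorem analyticOnNhd_polyRemainder (m : ℕ) :
    AnalyticOnNhd ℂ (polyRemainder m) {w | expQuot w ≠ 0} := by
  have h := differentiableOn_expRemainder.analyticOnNhd isOpen_expQuot_ne_zero
  have h2 : ∀ k, AnalyticOnNhd ℂ (iteratedDeriv k expRemainder) {w | expQuot w ≠ 0} := by
    intro k
    induction k with
    | zero => simpa using h
    | succ k ih => rw [iteratedDeriv_succ]; exact ih.deriv
  exact analyticOnNhd_const.mul (h2 m)

theorem hasDerivAt_polyRemainder (m : ℕ) {w : ℂ} (hw : expQuot w ≠ 0) :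
    HasDerivAt (polyRemainder m) (-polyRemainder (m + 1) w) w := by
  have h := (analyticOnNhd_polyRemainder m w hw).differentiableAt.hasDerivAt
  convert! h using 1
  have : deriv (polyRemainder m) w = (-1) ^ m * deriv (iteratedDeriv m expRemainder) w := by
    rw [← deriv_const_mul_field]; rfl
  rw [this, polyRemainder, iteratedDeriv_succ]; ring

/-- In a sector around the positive axis, and near the origin, the remainder and its derivatives
decay at the rate of Cauchy's estimates. -/
theorem exists_norm_polyRemainder_le (m : ℕ) : ∃ C : ℝ, 0 ≤ C ∧ ∀ w : ℂ,
    (‖w‖ ≤ 2 ∨ ‖w‖ ≤ 8 * w.re) → ‖polyRemainder m w‖ ≤ C / (1 + ‖w‖) ^ (m + 1) := by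
  obtain ⟨C, hC0, hC⟩ := exists_norm_expRemainder_le
  refine ⟨m.factorial * (2 * C) * 48 ^ m, by positivity, fun w hw => ?_⟩
  have hn := norm_nonneg w
  -- The radius is small enough for the circle to stay in the region where the undifferentiated
  -- function is bounded, and proportional to `1 + ‖w‖`.
  set R : ℝ := (1 + ‖w‖) / 48 with hR
  have hR0 : 0 < R := by positivity
  have geo : ∀ v ∈ Metric.closedBall w R, (‖v‖ ≤ 3 ∨ ‖v‖ ≤ 17 * v.re) ∧
      (1 + ‖w‖) / 2 ≤ 1 + ‖v‖ := by
    intro v hv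
    rw [mem_closedBall_iff_norm] at hv
    have h1 : ‖v‖ ≤ ‖w‖ + R := by linarith [norm_le_norm_add_norm_sub' v w]
    have h2 : ‖w‖ - R ≤ ‖v‖ := by
      have := norm_le_norm_add_norm_sub' w v
      rw [norm_sub_rev] at this; linarith
    have h3 : w.re - R ≤ v.re := by
      have := (Complex.abs_re_le_norm (v - w)).trans hv
      rw [Complex.sub_re] at this
      linarith [(abs_le.mp this).1]
    refine ⟨?_, by linarith⟩
    rcases le_or_gt ‖w‖ 2 with h | h
    · left; linarith
    · right
      have := hw.resolve_left (not_le.mpr h)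
      linarith
  have hd : DiffContOnCl ℂ expRemainder (Metric.ball w R) := by
    refine DifferentiableOn.diffContOnCl (differentiableOn_expRemainder.mono fun v hv => ?_)
    rcases (geo v (Metric.closure_ball_subset_closedBall hv)).1 with h | h
    · exact expQuot_ne_zero_of_norm_lt (by linarith [Real.pi_gt_three])
    · rcases eq_or_ne v 0 with rfl | h0
      · simp [expQuot_zero]
      · exact expQuot_ne_zero_of_re_pos (by linarith [norm_pos_iff.mpr h0])
  have key := Complex.norm_iteratedDeriv_le_of_forall_mem_sphere_norm_le m hR0 hd
    (C := 2 * C / (1 + ‖w‖)) fun v hv => by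
      obtain ⟨g1, g2⟩ := geo v (Metric.sphere_subset_closedBall hv)
      refine (hC v g1).trans ?_
      rw [div_le_div_iff₀ (by positivity) (by positivity)]
      nlinarith
  rw [polyRemainder, norm_mul, norm_pow, norm_neg, norm_one, one_pow, one_mul]
  refine key.trans (le_of_eq ?_)
  rw [hR, div_pow, pow_succ]
  field_simp

/-! ### The power sums `∑ k^m e^{-kw}` -/

/-- The series `∑ k^m e^{-kw}` over `k ≥ 1`. -/
noncomputable def expPowerSum (m : ℕ) (w : ℂ) : ℂ :=
  ∑' k : ℕ, (k + 1 : ℂ) ^ m * Complex.exp (-((k + 1) * w))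

theorem norm_succ_pow_mul_exp (m k : ℕ) (w : ℂ) :
    ‖(k + 1 : ℂ) ^ m * Complex.exp (-((k + 1) * w))‖
      = ((k : ℝ) + 1) ^ m * Real.exp (-((k + 1) * w.re)) := by
  have e : (k + 1 : ℂ) ^ m * Complex.exp (-((k + 1) * w))
      = ((((k : ℝ) + 1) ^ m : ℝ) : ℂ) * Complex.exp (-((((k : ℝ) + 1 : ℝ) : ℂ) * w)) := by
    push_cast; rfl
  rw [e, norm_mul, Complex.norm_exp, Complex.norm_real, Real.norm_of_nonneg (by positivity),
    Complex.neg_re, Complex.re_ofReal_mul]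

theorem hasSum_expPowerSum (m : ℕ) {w : ℂ} (hw : 0 < w.re) :
    HasSum (fun k : ℕ => (k + 1 : ℂ) ^ m * Complex.exp (-((k + 1) * w))) (expPowerSum m w) := by
  refine Summable.hasSum (Summable.of_norm ?_)
  simp_rw [norm_succ_pow_mul_exp]
  exact summable_succ_pow_mul_exp m hw

theorem hasDerivAt_expPowerSum (m : ℕ) {w : ℂ} (hw : 0 < w.re) :
    HasDerivAt (expPowerSum m) (-expPowerSum (m + 1) w) w := by
  -- Termwise differentiation, uniformly on the half-plane `Re v > Re w / 2`.
  have hε : 0 < w.re / 2 := by positivity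
  have hmem : w ∈ {v : ℂ | w.re / 2 < v.re} := by simp only [Set.mem_ofPred_eq]; linarith
  have h := hasDerivAt_tsum_of_isPreconnected (summable_succ_pow_mul_exp (m + 1) hε)
    (t := {v : ℂ | w.re / 2 < v.re})
    (g := fun (k : ℕ) v => (k + 1 : ℂ) ^ m * Complex.exp (-((k + 1) * v)))
    (g' := fun (k : ℕ) v => -((k + 1 : ℂ) ^ (m + 1) * Complex.exp (-((k + 1) * v))))
    (y₀ := w) (y := w)
    (isOpen_lt continuous_const Complex.continuous_re)
    (convex_halfSpace_re_gt _).isPreconnected ?_ ?_ hmem (hasSum_expPowerSum m hw).summable hmem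
  · rw [tsum_neg] at h
    exact h
  · intro k v _
    have h1 : HasDerivAt (fun v : ℂ => -((k + 1 : ℂ) * v)) (-(k + 1 : ℂ)) v := by
      simpa using ((hasDerivAt_id v).const_mul (k + 1 : ℂ)).fun_neg
    convert! h1.cexp.const_mul ((k + 1 : ℂ) ^ m) using 1
    ring
  · intro k v hv
    rw [norm_neg, norm_succ_pow_mul_exp]
    gcongr
    exact le_of_lt hv

theorem polyRemainder_of_re_pos (m : ℕ) {w : ℂ} (hw : 0 < w.re) :
    polyRemainder m w = expPowerSum m w - m.factorial / w ^ (m + 1) := by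
  induction m generalizing w with
  | zero =>
    have h1 : ‖Complex.exp (-w)‖ < 1 := by rw [Complex.norm_exp]; simpa using hw
    have h2 := (hasSum_geometric_of_norm_lt_one h1).mul_left (Complex.exp (-w))
    have h3 : HasSum (fun k : ℕ => (k + 1 : ℂ) ^ 0 * Complex.exp (-((k + 1) * w)))
        (Complex.exp (-w) * (1 - Complex.exp (-w))⁻¹) := by
      convert! h2 using 2 with k
      rw [← Complex.exp_nat_mul, ← Complex.exp_add, pow_zero, one_mul]
      congr 1; ring
    rw [(hasSum_expPowerSum 0 hw).unique h3, polyRemainder]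
    simp only [pow_zero, iteratedDeriv_zero, one_mul, zero_add, pow_one, Nat.factorial_zero,
      Nat.cast_one, one_div]
    rw [expRemainder_of_re_pos hw, Complex.exp_neg]
    have h4 : Complex.exp w ≠ 0 := Complex.exp_ne_zero w
    congr 1
    rw [← mul_inv, mul_sub, mul_one, mul_inv_cancel₀ h4]
  | succ m ih =>
    have h0 : w ≠ 0 := fun h => by simp [h] at hw
    have e1 := hasDerivAt_polyRemainder m (expQuot_ne_zero_of_re_pos hw)
    have e2 : HasDerivAt (fun w : ℂ => (m.factorial : ℂ) / w ^ (m + 1))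
        (-((m + 1).factorial / w ^ (m + 1 + 1))) w := by
      convert! ((hasDerivAt_pow (m + 1) w).fun_inv (pow_ne_zero _ h0)).const_mul
        (m.factorial : ℂ) using 1
      rw [Nat.factorial_succ]
      push_cast
      field_simp
      simp
      ring
    have e3 := (hasDerivAt_expPowerSum m hw).sub e2
    have ev : polyRemainder m =ᶠ[nhds w]
        (expPowerSum m - fun w => (m.factorial : ℂ) / w ^ (m + 1)) := by
      filter_upwards [(isOpen_lt continuous_const Complex.continuous_re).mem_nhds hw] with v hv
      exact ih hv
    have := e1.unique (e3.congr_of_eventuallyEq ev)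
    linear_combination -this

/-! ### The constant terms as values of the zeta function -/

/-- `polyRemainder m` minus a multiple of `e^{-w}` so that it vanishes at `w = 0`. -/
noncomputable def centeredRemainder (m : ℕ) (w : ℂ) : ℂ :=
  polyRemainder m w - polyRemainder m 0 * Complex.exp (-w)

theorem centeredRemainder_zero (m : ℕ) : centeredRemainder m 0 = 0 := by
  simp [centeredRemainder]

theorem expQuot_ofReal_ne_zero {t : ℝ} (ht : 0 ≤ t) : expQuot t ≠ 0 := by
  rcases ht.eq_or_lt with rfl | h
  · simp [expQuot_zero]
  · exact expQuot_ne_zero_of_re_pos (by simpa using h)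

theorem analyticOnNhd_centeredRemainder (m : ℕ) :
    AnalyticOnNhd ℂ (centeredRemainder m) {w | expQuot w ≠ 0} :=
  (analyticOnNhd_polyRemainder m).sub (analyticOnNhd_const.mul fun w _ =>
    (by fun_prop : Differentiable ℂ fun w : ℂ => Complex.exp (-w)).analyticAt w)

theorem continuousOn_centeredRemainder (m : ℕ) :
    ContinuousOn (fun t : ℝ => centeredRemainder m t) (Set.Ici 0) := fun t ht =>
  ((analyticOnNhd_centeredRemainder m t (expQuot_ofReal_ne_zero ht)).continuousAt.comp
    Complex.continuous_ofReal.continuousAt).continuousWithinAt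

theorem centeredRemainder_isBigO (m : ℕ) :
    (fun t : ℝ => centeredRemainder m t) =O[nhdsWithin 0 (Set.Ioi 0)] fun t : ℝ => t := by
  have h := (analyticOnNhd_centeredRemainder m 0 (by simp [expQuot_zero])).differentiableAt.isBigO_sub
  simp only [centeredRemainder_zero, sub_zero] at h
  have h2 : Tendsto (fun t : ℝ => (t : ℂ)) (nhdsWithin 0 (Set.Ioi 0)) (nhds 0) :=
    (Complex.continuous_ofReal.tendsto' 0 0 (by simp)).mono_left nhdsWithin_le_nhds
  exact (h.comp_tendsto h2).trans (IsBigO.of_bound 1 (Eventually.of_forall fun t => by simp))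

theorem norm_expPowerSum_le (m : ℕ) {t : ℝ} (ht : 1 ≤ t) :
    ‖expPowerSum m t‖ ≤ (Real.exp 1 * ∑' k : ℕ, ((k : ℝ) + 1) ^ m * Real.exp (-((k + 1) * 1)))
      * Real.exp (-t) := by
  have hs := summable_succ_pow_mul_exp m one_pos
  rw [mul_right_comm, ← Real.exp_add, ← tsum_mul_left]
  refine tsum_of_norm_bounded (hs.mul_left _).hasSum fun k => ?_
  rw [norm_succ_pow_mul_exp, Complex.ofReal_re, mul_left_comm, ← Real.exp_add]
  gcongr
  nlinarith [k.cast_nonneg (α := ℝ)]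

theorem continuousOn_expPowerSum (m : ℕ) :
    ContinuousOn (fun t : ℝ => expPowerSum m t) (Set.Ioi 0) := fun t ht =>
  ((hasDerivAt_expPowerSum m (w := t) (by simpa using ht)).continuousAt.comp
    Complex.continuous_ofReal.continuousAt).continuousWithinAt

theorem mellin_expPowerSum (m : ℕ) {s : ℂ} (hs : m + 1 < s.re) :
    mellin (fun t : ℝ => expPowerSum m t) s = Complex.Gamma s * riemannZeta (s - m) := by
  have hs0 : 0 < s.re := by linarith [m.cast_nonneg (α := ℝ)]
  have h := hasSum_mellin (a := fun i : ℕ => (i + 1 : ℂ) ^ m) (p := fun i : ℕ => (i : ℝ) + 1)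
    (F := fun t : ℝ => expPowerSum m t) (s := s) (fun i => Or.inr (by positivity)) hs0 ?_ ?_
  · have hz := zeta_eq_tsum_one_div_nat_add_one_cpow (s := s - m)
      (by rw [Complex.sub_re, Complex.natCast_re]; linarith)
    rw [← h.tsum_eq, hz, ← tsum_mul_left]
    refine tsum_congr fun k => ?_
    have hk : (k + 1 : ℂ) ≠ 0 := by exact_mod_cast Nat.succ_ne_zero k
    rw [Complex.cpow_sub _ _ hk, Complex.cpow_natCast]
    push_cast
    field_simp
  · intro t ht
    convert! hasSum_expPowerSum m (w := t) (by simpa using ht) using 2 with k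
    push_cast
    ring_nf
  · have : Summable fun n : ℕ => 1 / (((n + 1 : ℕ) : ℝ)) ^ (s.re - m) :=
      (summable_nat_add_iff 1).mpr (Real.summable_one_div_nat_rpow.mpr (by linarith))
    refine this.congr fun k => ?_
    have hk : (0 : ℝ) < k + 1 := by positivity
    have e : ‖(k + 1 : ℂ) ^ m‖ = ((k : ℝ) + 1) ^ m := by
      rw [norm_pow]; congr 1; exact_mod_cast Complex.norm_natCast (k + 1)
    push_cast
    rw [e, Real.rpow_sub hk, Real.rpow_natCast]
    field_simp

theorem hasMellin_exp_neg {s : ℂ} (hs : 0 < s.re) :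
    HasMellin (fun t : ℝ => Complex.exp (-t)) s (Complex.Gamma s) := by
  have h := Complex.GammaIntegral_convergent hs
  have e : ∀ t : ℝ, (t : ℂ) ^ (s - 1) • Complex.exp (-t)
      = ((Real.exp (-t) : ℝ) : ℂ) * (t : ℂ) ^ (s - 1) := fun t => by
    push_cast; rw [smul_eq_mul, mul_comm]
  constructor
  · rw [MellinConvergent]; simp_rw [e]; exact h
  · rw [mellin, Complex.Gamma_eq_integral hs, Complex.GammaIntegral]; simp_rw [e]

/-- The part over `(0, 1]` of the Mellin integrand. -/
noncomputable def nearPart (m : ℕ) : ℝ → ℂ :=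
  (Set.Ioc 0 1).indicator fun t => centeredRemainder m t

/-- The part over `(1, ∞)` of the Mellin integrand. -/
noncomputable def farPart (m : ℕ) : ℝ → ℂ :=
  (Set.Ioi 1).indicator fun t => expPowerSum m t - polyRemainder m 0 * Complex.exp (-t)

theorem locallyIntegrable_nearPart (m : ℕ) : MeasureTheory.LocallyIntegrable (nearPart m) := by
  refine MeasureTheory.Integrable.locallyIntegrable ?_
  rw [nearPart, MeasureTheory.integrable_indicator_iff measurableSet_Ioc]
  exact ((continuousOn_centeredRemainder m).mono fun t ht => ht.1).integrableOn_Icc.mono_set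
    Set.Ioc_subset_Icc_self

theorem continuousOn_far (m : ℕ) : ContinuousOn (fun t : ℝ => expPowerSum m t -
    polyRemainder m 0 * Complex.exp (-t)) (Set.Ioi 0) :=
  (continuousOn_expPowerSum m).sub (by fun_prop)

theorem farPart_isBigO (m : ℕ) : (farPart m) =O[atTop] fun t => Real.exp (-1 * t) := by
  refine IsBigO.of_bound ((Real.exp 1 * ∑' k : ℕ, ((k : ℝ) + 1) ^ m * Real.exp (-((k + 1) * 1)))
    + ‖polyRemainder m 0‖) ?_
  filter_upwards [eventually_gt_atTop 1] with t ht
  rw [farPart, Set.indicator_of_mem (Set.mem_Ioi.mpr ht), Real.norm_of_nonneg (Real.exp_pos _).le,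
    add_mul, neg_one_mul]
  refine (norm_sub_le _ _).trans (add_le_add (norm_expPowerSum_le m ht.le) ?_)
  rw [norm_mul, Complex.norm_exp]; simp

theorem locallyIntegrable_farPart (m : ℕ) : MeasureTheory.LocallyIntegrable (farPart m) := by
  rw [farPart, MeasureTheory.locallyIntegrable_iff]
  intro K hK
  rw [MeasureTheory.IntegrableOn, MeasureTheory.integrable_indicator_iff measurableSet_Ioi,
    MeasureTheory.IntegrableOn, MeasureTheory.Measure.restrict_restrict measurableSet_Ioi]
  obtain ⟨B, hB⟩ := hK.bddAbove
  refine (((continuousOn_far m).mono fun t (ht : t ∈ Set.Icc 1 B) =>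
    one_pos.trans_le ht.1).integrableOn_Icc).mono_set fun t ht => ⟨le_of_lt ht.1, hB ht.2⟩

theorem nearPart_isBigO_atTop (m : ℕ) (a : ℝ) : nearPart m =O[atTop] fun t => t ^ (-a) := by
  refine EventuallyEq.trans_isBigO (f₂ := fun _ => (0 : ℂ)) ?_ (isBigO_zero _ _)
  filter_upwards [eventually_gt_atTop 1] with t ht
  exact Set.indicator_of_notMem (fun h => not_lt.mpr h.2 ht) _

theorem nearPart_isBigO_zero (m : ℕ) :
    nearPart m =O[nhdsWithin 0 (Set.Ioi 0)] fun t => t ^ (-(-1) : ℝ) := by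
  simp only [neg_neg, Real.rpow_one]
  refine EventuallyEq.trans_isBigO ?_ (centeredRemainder_isBigO m)
  filter_upwards [Ioc_mem_nhdsGT one_pos] with t ht
  exact Set.indicator_of_mem ht _

theorem farPart_isBigO_zero (m : ℕ) (b : ℝ) :
    farPart m =O[nhdsWithin 0 (Set.Ioi 0)] fun t => t ^ (-b) := by
  refine EventuallyEq.trans_isBigO (f₂ := fun _ => (0 : ℂ)) ?_ (isBigO_zero _ _)
  filter_upwards [Ioc_mem_nhdsGT one_pos] with t ht
  exact Set.indicator_of_notMem (fun h => not_lt.mpr ht.2 h) _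

theorem mellinConvergent_nearPart (m : ℕ) {s : ℂ} (hs : -1 < s.re) :
    MellinConvergent (nearPart m) s :=
  mellinConvergent_of_isBigO_rpow (locallyIntegrable_nearPart m |>.locallyIntegrableOn _)
    (nearPart_isBigO_atTop m (s.re + 1)) (by linarith) (nearPart_isBigO_zero m) hs

theorem mellinConvergent_farPart (m : ℕ) (s : ℂ) : MellinConvergent (farPart m) s :=
  mellinConvergent_of_isBigO_rpow_exp one_pos (locallyIntegrable_farPart m |>.locallyIntegrableOn _)
    (farPart_isBigO m) (farPart_isBigO_zero m (s.re - 1)) (by linarith)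

theorem differentiableAt_mellin_nearPart (m : ℕ) {s : ℂ} (hs : -1 < s.re) :
    DifferentiableAt ℂ (mellin (nearPart m)) s :=
  mellin_differentiableAt_of_isBigO_rpow (locallyIntegrable_nearPart m |>.locallyIntegrableOn _)
    (nearPart_isBigO_atTop m (s.re + 1)) (by linarith) (nearPart_isBigO_zero m) hs

theorem differentiableAt_mellin_farPart (m : ℕ) (s : ℂ) :
    DifferentiableAt ℂ (mellin (farPart m)) s :=
  mellin_differentiableAt_of_isBigO_rpow_exp one_pos
    (locallyIntegrable_farPart m |>.locallyIntegrableOn _)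
    (farPart_isBigO m) (farPart_isBigO_zero m (s.re - 1)) (by linarith)

/-- For `Re s > m + 1` every part of the Mellin integral converges by itself; the polar part over
`(0, 1]` contributes `m! / (s - m - 1)`. -/
theorem mellin_parts_of_large_re (m : ℕ) {s : ℂ} (hs : m + 1 < s.re) :
    mellin (nearPart m) s + mellin (farPart m) s + m.factorial / (s - (m + 1))
      = Complex.Gamma s * (riemannZeta (s - m) - polyRemainder m 0) := by
  have hs0 : 0 < s.re := by linarith [m.cast_nonneg (α := ℝ)]
  have h3 := hasMellin_cpow_Ioc (-(m + 1 : ℂ)) (s := s) (by simp; linarith)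
  have h3' := hasMellin_const_smul h3.1 (m.factorial : ℂ)
  have h1 := mellinConvergent_nearPart m (s := s) (by linarith)
  have h2 := mellinConvergent_farPart m s
  have h4 := hasMellin_exp_neg hs0
  have h4' := hasMellin_const_smul h4.1 (polyRemainder m 0)
  have h12 := hasMellin_add h1 h2
  have h123 := hasMellin_add h12.1 h3'.1
  have h1234 := hasMellin_add h123.1 h4'.1
  have key := mellin_expPowerSum m hs
  -- On `(0, 1]` the sum `expPowerSum` is the near part plus its polar part plus the multiple of
  -- `e^{-t}`; on `(1, ∞)` it is the far part plus that multiple.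
  have e : mellin (fun t : ℝ => expPowerSum m t) s = mellin (fun t => nearPart m t + farPart m t
      + (m.factorial : ℂ) • (Set.Ioc 0 1).indicator (fun t : ℝ => (t : ℂ) ^ (-(m + 1 : ℂ))) t
      + polyRemainder m 0 • Complex.exp (-t)) s := by
    rw [mellin, mellin]
    refine MeasureTheory.setIntegral_congr_fun measurableSet_Ioi fun t ht => ?_
    congr 1
    have ht0 : (0 : ℝ) < t := ht
    rcases le_or_gt t 1 with h | h
    · rw [nearPart, farPart, Set.indicator_of_mem (Set.mem_Ioc.mpr ⟨ht0, h⟩),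
        Set.indicator_of_notMem (by simpa using h),
        Set.indicator_of_mem (Set.mem_Ioc.mpr ⟨ht0, h⟩), centeredRemainder,
        polyRemainder_of_re_pos m (w := t) (by simpa using ht0), Complex.cpow_neg,
        show (m + 1 : ℂ) = ((m + 1 : ℕ) : ℂ) by push_cast; rfl, Complex.cpow_natCast]
      simp only [smul_eq_mul, div_eq_mul_inv]
      ring
    · rw [nearPart, farPart, Set.indicator_of_notMem (fun h' => not_le.mpr h h'.2),
        Set.indicator_of_mem (Set.mem_Ioi.mpr h),
        Set.indicator_of_notMem (fun h' => not_le.mpr h h'.2)]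
      simp
  rw [h1234.2, h123.2, h12.2, h3'.2, h4'.2, h3.2, h4.2, key] at e
  simp only [smul_eq_mul] at e
  rw [mul_sub, e, sub_eq_add_neg s]
  ring

/-- `(s - 1) ζ(s)`, with its value at `s = 1`. -/
noncomputable def zetaTimes : ℂ → ℂ := Function.update (fun s => (s - 1) * riemannZeta s) 1 1

theorem zetaTimes_of_ne {s : ℂ} (hs : s ≠ 1) : zetaTimes s = (s - 1) * riemannZeta s := by
  simp [zetaTimes, hs]

theorem differentiable_zetaTimes : Differentiable ℂ zetaTimes := by
  rw [← differentiableOn_univ]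
  refine (Complex.differentiableOn_compl_singleton_and_continuousAt_iff
    (univ_mem : Set.univ ∈ nhds (1 : ℂ))).mp ⟨fun s hs => ?_, ?_⟩
  · have hs1 : s ≠ 1 := by simpa using hs
    have h : DifferentiableAt ℂ (fun s => (s - 1) * riemannZeta s) s :=
      (by fun_prop : DifferentiableAt ℂ (fun s : ℂ => s - 1) s).mul
        (differentiableAt_riemannZeta hs1)
    refine (h.congr_of_eventuallyEq ?_).differentiableWithinAt
    filter_upwards [isOpen_ne.mem_nhds hs1] with v hv using zetaTimes_of_ne hv
  · exact continuousAt_update_same.mpr riemannZeta_residue_one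

/-- Analytic continuation of the Mellin transform identity to `Re s > -1`, cleared of the
denominators `s` and `s - m - 1`. -/
theorem mellin_parts_continued (m : ℕ) {s : ℂ} (hs : -1 < s.re) :
    (s - (m + 1)) * (s * (mellin (nearPart m) s + mellin (farPart m) s)) + m.factorial * s
      = Complex.Gamma (s + 1) * (zetaTimes (s - m) - (s - (m + 1)) * polyRemainder m 0) := by
  have hopen : IsOpen {s : ℂ | -1 < s.re} := isOpen_lt continuous_const Complex.continuous_re
  have hL : DifferentiableOn ℂ (fun s => (s - (m + 1)) * (s * (mellin (nearPart m) s +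
      mellin (farPart m) s)) + m.factorial * s) {s : ℂ | -1 < s.re} := by
    intro s hs
    have h1 := differentiableAt_mellin_nearPart m hs
    have h2 := differentiableAt_mellin_farPart m s
    exact DifferentiableAt.differentiableWithinAt (by fun_prop)
  have hR : DifferentiableOn ℂ (fun s => Complex.Gamma (s + 1) * (zetaTimes (s - m) -
      (s - (m + 1)) * polyRemainder m 0)) {s : ℂ | -1 < s.re} := by
    intro s hs
    have hs' : -1 < s.re := hs
    have h1 : DifferentiableAt ℂ (fun s => Complex.Gamma (s + 1)) s := by
      refine DifferentiableAt.comp s (g := Complex.Gamma)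
        (Complex.differentiableAt_Gamma _ fun k hk => ?_) (by fun_prop)
      have := congrArg Complex.re hk
      simp at this
      linarith [k.cast_nonneg (α := ℝ)]
    have h2 : DifferentiableAt ℂ (fun s => zetaTimes (s - m)) s :=
      (differentiable_zetaTimes _).comp s (by fun_prop)
    exact DifferentiableAt.differentiableWithinAt (by fun_prop)
  -- Both sides are analytic on the half-plane and agree near `s = m + 2`.
  refine (hL.analyticOnNhd hopen).eqOn_of_preconnected_of_eventuallyEq (hR.analyticOnNhd hopen)
    (convex_halfSpace_re_gt _).isPreconnected (z₀ := (m + 2 : ℂ)) ?_ ?_ hs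
  · simp; linarith [m.cast_nonneg (α := ℝ)]
  · have : {s : ℂ | (m : ℝ) + 1 < s.re} ∈ nhds (m + 2 : ℂ) :=
      (isOpen_lt continuous_const Complex.continuous_re).mem_nhds (by simp)
    filter_upwards [this] with s hs
    have hs' : (m : ℝ) + 1 < s.re := hs
    have h0 : s ≠ 0 := fun h => by simp [h] at hs'; linarith [m.cast_nonneg (α := ℝ)]
    have h1 : s - (m + 1) ≠ 0 := fun h => by
      have := congrArg Complex.re h
      simp at this; linarith
    have h2 : s - m ≠ 1 := fun h => h1 (by linear_combination h)
    have key := mellin_parts_of_large_re m hs'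
    rw [zetaTimes_of_ne h2, Complex.Gamma_add_one _ h0,
      show mellin (nearPart m) s + mellin (farPart m) s = Complex.Gamma s *
      (riemannZeta (s - m) - polyRemainder m 0) - m.factorial / (s - (m + 1)) by
        rw [← key]; ring]
    field_simp
    ring

theorem neg_natCast_ne_one (m : ℕ) : (-(m : ℂ)) ≠ 1 := fun h => by
  have := congrArg Complex.re h
  simp at this; linarith [m.cast_nonneg (α := ℝ)]

/-- The value at `0` is read off from the continued Mellin identity at `s = 0`, where the left-hand
side vanishes. -/
theorem polyRemainder_zero (m : ℕ) : polyRemainder m 0 = riemannZeta (-m) := by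
  have h := mellin_parts_continued m (s := 0) (by simp)
  rw [zero_sub, zero_sub, zetaTimes_of_ne (neg_natCast_ne_one m)] at h
  simp only [zero_add, Complex.Gamma_one, mul_zero, zero_mul, one_mul] at h
  have h1 : (m + 1 : ℂ) ≠ 0 := by exact_mod_cast Nat.succ_ne_zero m
  exact mul_left_cancel₀ h1 (by linear_combination -h)

/-- The continued Mellin transform at `s = 0`: the pole of `Γ` there cancels the zero of
`ζ(s - m) - ζ(-m)`. -/
theorem mellin_parts_zero (m : ℕ) :
    mellin (nearPart m) 0 + mellin (farPart m) 0 - m.factorial / (m + 1)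
      = deriv riemannZeta (-m) := by
  have h1 : (m + 1 : ℂ) ≠ 0 := by exact_mod_cast Nat.succ_ne_zero m
  have c1 := (differentiableAt_mellin_nearPart m (s := 0) (by simp)).continuousAt
  have c2 := (differentiableAt_mellin_farPart m 0).continuousAt
  -- Dividing the continued identity by `s` and letting `s → 0`, the right-hand side becomes the
  -- difference quotient of `ζ` at `-m`.
  have tL : Tendsto (fun s : ℂ => (s - (m + 1)) * (mellin (nearPart m) s + mellin (farPart m) s)
      + m.factorial) (nhdsWithin 0 {0}ᶜ) (nhds ((0 - (m + 1)) * (mellin (nearPart m) 0 +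
        mellin (farPart m) 0) + m.factorial)) := by
    have : ContinuousAt (fun s : ℂ => (s - (m + 1)) *
        (mellin (nearPart m) s + mellin (farPart m) s) + m.factorial) 0 := by fun_prop
    exact this.tendsto.mono_left nhdsWithin_le_nhds
  have hd : HasDerivAt (fun s : ℂ => riemannZeta (s - m)) (deriv riemannZeta (-m)) 0 := by
    have := (differentiableAt_riemannZeta (neg_natCast_ne_one m)).hasDerivAt
    rw [← zero_sub (m : ℂ)] at this
    simpa using this.comp_sub_const 0 (m : ℂ)
  have tS := hasDerivAt_iff_tendsto_slope.mp hd
  have tG : Tendsto (fun s : ℂ => (s - (m + 1)) * Complex.Gamma (s + 1)) (nhdsWithin 0 {0}ᶜ)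
      (nhds ((0 - (m + 1)) * Complex.Gamma (0 + 1))) := by
    have h2 : ContinuousAt (fun s : ℂ => Complex.Gamma (s + 1)) 0 :=
      ContinuousAt.comp' (by simp [Complex.continuousAt_Gamma_one])
        (continuous_add_const 1).continuousAt
    have : ContinuousAt (fun s : ℂ => (s - (m + 1)) * Complex.Gamma (s + 1)) 0 := by fun_prop
    exact this.tendsto.mono_left nhdsWithin_le_nhds
  have key := tendsto_nhds_unique_of_eventuallyEq tL (tG.mul tS) ?_
  · rw [zero_add, Complex.Gamma_one] at key
    refine mul_left_cancel₀ h1 ?_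
    field_simp
    linear_combination -key
  · have hn : {s : ℂ | -1 < s.re} ∈ nhdsWithin (0 : ℂ) {0}ᶜ :=
      nhdsWithin_le_nhds ((isOpen_lt continuous_const Complex.continuous_re).mem_nhds (by simp))
    have hb : {s : ℂ | s.re < 1} ∈ nhdsWithin (0 : ℂ) {0}ᶜ :=
      nhdsWithin_le_nhds ((isOpen_lt Complex.continuous_re continuous_const).mem_nhds (by simp))
    filter_upwards [hn, hb, self_mem_nhdsWithin] with s hs hs1 hs0
    have h0 : s ≠ 0 := hs0
    have h2 : s - m ≠ 1 := fun h => by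
      have e := congrArg Complex.re h
      have hs1' : s.re < 1 := hs1
      simp at e; linarith [m.cast_nonneg (α := ℝ)]
    have e := mellin_parts_continued m hs
    rw [zetaTimes_of_ne h2, polyRemainder_zero] at e
    rw [slope_def_field, zero_sub, sub_zero]
    field_simp
    linear_combination e

/-! ### The quotient of the centered remainder by `w` -/

/-- The analytic function `centeredRemainder m w / w`. -/
noncomputable def remainderQuot (m : ℕ) : ℂ → ℂ := dslope (centeredRemainder m) 0

theorem remainderQuot_of_ne (m : ℕ) {w : ℂ} (hw : w ≠ 0) :
    remainderQuot m w = centeredRemainder m w / w := by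
  rw [remainderQuot, dslope_of_ne _ hw, slope_def_field, centeredRemainder_zero, sub_zero, sub_zero]

theorem analyticOnNhd_remainderQuot (m : ℕ) :
    AnalyticOnNhd ℂ (remainderQuot m) {w | expQuot w ≠ 0} := by
  refine DifferentiableOn.analyticOnNhd ?_ isOpen_expQuot_ne_zero
  exact (Complex.differentiableOn_dslope
    (isOpen_expQuot_ne_zero.mem_nhds (by simp [expQuot_zero]))).mpr
    (analyticOnNhd_centeredRemainder m).differentiableOn

theorem continuousOn_remainderQuot (m : ℕ) :
    ContinuousOn (fun t : ℝ => remainderQuot m t) (Set.Ici 0) := fun t ht =>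
  ((analyticOnNhd_remainderQuot m t (expQuot_ofReal_ne_zero ht)).continuousAt.comp
    Complex.continuous_ofReal.continuousAt).continuousWithinAt

/-- The integral of `centeredRemainder m t / t` is `ζ'(-m)`. -/
theorem integrableOn_remainderQuot_and_integral (m : ℕ) :
    MeasureTheory.IntegrableOn (fun t : ℝ => remainderQuot m t) (Set.Ioi 0) ∧
    ∫ t in Set.Ioi (0 : ℝ), remainderQuot m t = deriv riemannZeta (-m) := by
  have hre : (-(m + 2 : ℂ)).re < -1 := by simp; linarith [m.cast_nonneg (α := ℝ)]
  have i1 : MeasureTheory.IntegrableOn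
      (fun t : ℝ => (t : ℂ) ^ ((0 : ℂ) - 1) • nearPart m t) (Set.Ioi 0) :=
    mellinConvergent_nearPart m (s := 0) (by simp)
  have i2 : MeasureTheory.IntegrableOn
      (fun t : ℝ => (t : ℂ) ^ ((0 : ℂ) - 1) • farPart m t) (Set.Ioi 0) :=
    mellinConvergent_farPart m 0
  have i3 : MeasureTheory.IntegrableOn ((Set.Ioi (1 : ℝ)).indicator
      fun t : ℝ => (m.factorial : ℂ) * (t : ℂ) ^ (-(m + 2 : ℂ))) (Set.Ioi 0) := by
    refine MeasureTheory.Integrable.integrableOn ?_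
    rw [MeasureTheory.integrable_indicator_iff measurableSet_Ioi]
    exact (integrableOn_Ioi_cpow_of_lt hre one_pos).const_mul _
  have v3 : ∫ t in Set.Ioi (0 : ℝ), (Set.Ioi (1 : ℝ)).indicator
      (fun t : ℝ => (m.factorial : ℂ) * (t : ℂ) ^ (-(m + 2 : ℂ))) t = m.factorial / (m + 1) := by
    rw [MeasureTheory.setIntegral_indicator measurableSet_Ioi,
      Set.inter_eq_self_of_subset_right (Set.Ioi_subset_Ioi zero_le_one),
      MeasureTheory.integral_const_mul, integral_Ioi_cpow_of_lt hre one_pos]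
    have h1 : (m + 1 : ℂ) ≠ 0 := by exact_mod_cast Nat.succ_ne_zero m
    rw [show -(m + 2 : ℂ) + 1 = -(m + 1) by ring, Complex.ofReal_one, Complex.one_cpow,
      neg_div_neg_eq, mul_one_div]
  -- The integrand is recovered from the two Mellin integrands at `s = 0` by taking the polar part
  -- out of the far part.
  have e : Set.EqOn (fun t : ℝ => (t : ℂ) ^ ((0 : ℂ) - 1) • nearPart m t
      + (t : ℂ) ^ ((0 : ℂ) - 1) • farPart m t - (Set.Ioi (1 : ℝ)).indicator
      (fun t : ℝ => (m.factorial : ℂ) * (t : ℂ) ^ (-(m + 2 : ℂ))) t)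
      (fun t : ℝ => remainderQuot m t) (Set.Ioi 0) := by
    intro t ht
    have ht0 : (0 : ℝ) < t := ht
    have hc : (t : ℂ) ≠ 0 := by exact_mod_cast ht0.ne'
    simp only [zero_sub, Complex.cpow_neg_one, smul_eq_mul]
    rw [remainderQuot_of_ne m hc]
    rcases le_or_gt t 1 with h | h
    · rw [nearPart, farPart, Set.indicator_of_mem (Set.mem_Ioc.mpr ⟨ht0, h⟩),
        Set.indicator_of_notMem (by simpa using h), Set.indicator_of_notMem (by simpa using h)]
      ring
    · rw [nearPart, farPart, Set.indicator_of_notMem (fun h' => not_le.mpr h h'.2),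
        Set.indicator_of_mem (Set.mem_Ioi.mpr h), Set.indicator_of_mem (Set.mem_Ioi.mpr h),
        centeredRemainder, polyRemainder_of_re_pos m (w := t) (by simpa using ht0),
        Complex.cpow_neg, show (m + 2 : ℂ) = ((m + 2 : ℕ) : ℂ) by push_cast; rfl,
        Complex.cpow_natCast]
      field_simp
      ring
  have iS := (i1.add i2).sub i3
  refine ⟨iS.congr_fun e measurableSet_Ioi, ?_⟩
  rw [← MeasureTheory.setIntegral_congr_fun measurableSet_Ioi e, ← mellin_parts_zero m]
  exact (MeasureTheory.integral_sub (i1.add i2) i3).trans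
    (congrArg₂ (· - ·) (MeasureTheory.integral_add i1 i2) v3)

theorem exp_neg_le_inv {t : ℝ} (ht : 0 ≤ t) : Real.exp (-t) ≤ 1 / (1 + t) := by
  rw [Real.exp_neg, ← one_div]
  exact one_div_le_one_div_of_le (by positivity) (by linarith [Real.add_one_le_exp t])

theorem exists_norm_deriv_remainderQuot_le (m : ℕ) : ∃ C : ℝ, 0 ≤ C ∧ ∀ t : ℝ, 0 ≤ t →
    ‖deriv (remainderQuot m) t‖ ≤ C / (1 + t) ^ 2 := by
  have hcont : ContinuousOn (fun t : ℝ => deriv (remainderQuot m) t) (Set.Icc 0 1) := fun t ht =>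
    ((analyticOnNhd_remainderQuot m t (expQuot_ofReal_ne_zero ht.1)).deriv.continuousAt.comp
      Complex.continuous_ofReal.continuousAt).continuousWithinAt
  obtain ⟨C₀, hC₀⟩ := isCompact_Icc.exists_bound_of_continuousOn hcont
  have hC₀0 : 0 ≤ C₀ := (norm_nonneg _).trans (hC₀ 0 (by simp))
  obtain ⟨C₁, hC₁0, hC₁⟩ := exists_norm_polyRemainder_le m
  obtain ⟨C₂, hC₂0, hC₂⟩ := exists_norm_polyRemainder_le (m + 1)
  set ρ := ‖polyRemainder m 0‖ with hρ
  have hρ0 : 0 ≤ ρ := norm_nonneg _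
  refine ⟨4 * C₀ + (2 * (C₂ + ρ) + 4 * (C₁ + ρ)), by positivity, fun t ht => ?_⟩
  have hs : 0 < (1 + t) ^ 2 := by positivity
  rcases le_or_gt t 1 with h | h
  · rw [le_div_iff₀ hs]
    have h1 := hC₀ t ⟨ht, h⟩
    have h2 : (1 + t) ^ 2 ≤ 4 := by nlinarith
    calc _ ≤ C₀ * 4 := by gcongr
      _ ≤ _ := by nlinarith
  · have ht0 : 0 < t := by linarith
    have hc : (t : ℂ) ≠ 0 := by exact_mod_cast ht0.ne'
    have hn : ‖(t : ℂ)‖ = t := by rw [Complex.norm_real, Real.norm_of_nonneg ht]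
    have hE := expQuot_ofReal_ne_zero ht
    have d1 : HasDerivAt (centeredRemainder m)
        (-polyRemainder (m + 1) t + polyRemainder m 0 * Complex.exp (-t)) t := by
      have := (hasDerivAt_neg (t : ℂ)).cexp.const_mul (polyRemainder m 0)
      convert! (hasDerivAt_polyRemainder m hE).sub this using 1
      ring
    have d2 := d1.div (hasDerivAt_id (t : ℂ)) hc
    have ev : remainderQuot m =ᶠ[nhds (t : ℂ)] (centeredRemainder m / id) := by
      filter_upwards [isOpen_ne.mem_nhds hc] with w hw
      exact remainderQuot_of_ne m hw
    rw [(d2.congr_of_eventuallyEq ev).deriv]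
    have hexp : ‖Complex.exp (-t)‖ = Real.exp (-t) := by rw [Complex.norm_exp]; simp
    have hsec : ‖(t : ℂ)‖ ≤ 8 * (t : ℂ).re := by rw [hn, Complex.ofReal_re]; linarith
    have b1 : ‖centeredRemainder m t‖ ≤ C₁ + ρ := by
      refine (norm_sub_le _ _).trans (add_le_add ((hC₁ _ (Or.inr hsec)).trans ?_) ?_)
      · exact div_le_self hC₁0 (one_le_pow₀ (by rw [hn]; linarith))
      · rw [norm_mul, hexp]
        exact mul_le_of_le_one_right hρ0 (Real.exp_le_one_iff.mpr (by linarith))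
    have b2 : ‖-polyRemainder (m + 1) t + polyRemainder m 0 * Complex.exp (-t)‖
        ≤ (C₂ + ρ) / (1 + t) := by
      rw [add_div]
      refine (norm_add_le _ _).trans (add_le_add ?_ ?_)
      · rw [norm_neg]
        refine (hC₂ _ (Or.inr hsec)).trans ?_
        rw [hn]
        exact div_le_div_of_nonneg_left hC₂0 (by positivity)
          (le_self_pow₀ (by linarith) (by omega))
      · rw [norm_mul, hexp]
        calc _ ≤ ρ * (1 / (1 + t)) := by gcongr; exact exp_neg_le_inv ht
          _ = _ := by ring
    rw [norm_div, norm_pow, id_eq, mul_one, hn]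
    have b3 : ‖(-polyRemainder (m + 1) t + polyRemainder m 0 * Complex.exp (-t)) * t
        - centeredRemainder m t‖ ≤ (C₂ + ρ) / (1 + t) * t + (C₁ + ρ) := by
      refine (norm_sub_le _ _).trans (add_le_add ?_ b1)
      rw [norm_mul, hn]; gcongr
    calc _ ≤ ((C₂ + ρ) / (1 + t) * t + (C₁ + ρ)) / t ^ 2 := by gcongr
      _ = (C₂ + ρ) / (1 + t) / t + (C₁ + ρ) / t ^ 2 := by field_simp
      _ ≤ (C₂ + ρ) / (1 + t) / ((1 + t) / 2) + (C₁ + ρ) / ((1 + t) / 2) ^ 2 := by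
          gcongr <;> linarith
      _ = (2 * (C₂ + ρ) + 4 * (C₁ + ρ)) / (1 + t) ^ 2 := by field_simp; ring
      _ ≤ _ := div_le_div_of_nonneg_right (by linarith) hs.le

theorem norm_remainderQuot_sub_le {m : ℕ} {C : ℝ}
    (hC : ∀ t : ℝ, 0 ≤ t → ‖deriv (remainderQuot m) t‖ ≤ C / (1 + t) ^ 2) (hC0 : 0 ≤ C)
    {a b s t : ℝ} (ha : 0 ≤ a) (hs : s ∈ Set.Icc a b) (ht : t ∈ Set.Icc a b) :
    ‖remainderQuot m s - remainderQuot m t‖ ≤ C / (1 + a) ^ 2 * |s - t| := by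
  refine (convex_Icc a b).norm_image_sub_le_of_norm_hasDerivWithin_le
    (f := fun t : ℝ => remainderQuot m t) (f' := fun t : ℝ => deriv (remainderQuot m) t)
    (fun u hu => ?_) (fun u hu => ?_) ht hs
  · exact ((analyticOnNhd_remainderQuot m u (expQuot_ofReal_ne_zero
      (ha.trans hu.1))).differentiableAt.hasDerivAt.comp_ofReal).hasDerivWithinAt
  · refine (hC u (ha.trans hu.1)).trans ?_
    gcongr
    exact hu.1

/-! ### Riemann sums -/

theorem sum_inv_one_add_mul_sq_le {a : ℝ} (ha : 0 < a) (N : ℕ) :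
    ∑ i ∈ Finset.range N, 1 / (1 + i * a) ^ 2 ≤ (1 + a) / a := by
  -- Comparison with a telescoping sum: `a / (1 + i a)²` is at most
  -- `1 / (1 + (i - 1) a) - 1 / (1 + i a)`.
  have key : ∑ i ∈ Finset.range (N + 1), a / (1 + i * a) ^ 2 ≤ a + 1 - 1 / (1 + N * a) := by
    induction N with
    | zero => simp
    | succ N ih =>
      rw [Finset.sum_range_succ]
      have h1 : 0 < 1 + (N : ℝ) * a := by positivity
      have h2 : 0 < 1 + ((N + 1 : ℕ) : ℝ) * a := by positivity
      have h3 : a / (1 + ((N + 1 : ℕ) : ℝ) * a) ^ 2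
          ≤ 1 / (1 + (N : ℝ) * a) - 1 / (1 + ((N + 1 : ℕ) : ℝ) * a) := by
        rw [div_sub_div _ _ h1.ne' h2.ne', div_le_div_iff₀ (by positivity) (by positivity)]
        push_cast at h2 ⊢
        nlinarith [mul_pos (mul_pos ha ha) h2]
      linarith
  have h4 : ∑ i ∈ Finset.range N, a / (1 + i * a) ^ 2 ≤ a + 1 := by
    rw [Finset.sum_range_succ] at key
    have : 0 ≤ a / (1 + (N : ℝ) * a) ^ 2 := by positivity
    have : 0 ≤ 1 / (1 + (N : ℝ) * a) := by positivity
    linarith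
  rw [le_div_iff₀ ha, Finset.sum_mul]
  refine (Finset.sum_le_sum fun i _ => ?_).trans (h4.trans (by linarith))
  rw [div_mul_eq_mul_div, one_mul]

theorem summable_inv_one_add_mul_sq {a : ℝ} (ha : 0 < a) :
    Summable fun i : ℕ => 1 / (1 + i * a) ^ 2 :=
  summable_of_sum_range_le (fun _ => by positivity) (sum_inv_one_add_mul_sq_le ha)

theorem tsum_inv_one_add_mul_sq_le {a : ℝ} (ha : 0 < a) :
    ∑' i : ℕ, 1 / (1 + i * a) ^ 2 ≤ (1 + a) / a :=
  (summable_inv_one_add_mul_sq ha).tsum_le_of_sum_range_le (sum_inv_one_add_mul_sq_le ha)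

theorem norm_midpoint_error_le {m : ℕ} {C : ℝ}
    (hC : ∀ t : ℝ, 0 ≤ t → ‖deriv (remainderQuot m) t‖ ≤ C / (1 + t) ^ 2) (hC0 : 0 ≤ C)
    {x : ℝ} (hx : 0 < x) (i : ℕ) :
    ‖(∫ t in (i * (2 * x))..((i + 1 : ℕ) * (2 * x)), remainderQuot m t)
      - 2 * x * remainderQuot m ((2 * i + 1) * x : ℝ)‖
      ≤ 2 * C * x ^ 2 * (1 / (1 + i * (2 * x)) ^ 2) := by
  have hi := i.cast_nonneg (α := ℝ)
  set a : ℝ := i * (2 * x) with ha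
  have ha0 : 0 ≤ a := by positivity
  have hb : ((i + 1 : ℕ) : ℝ) * (2 * x) = a + 2 * x := by rw [ha]; push_cast; ring
  have hm : (2 * i + 1) * x = a + x := by rw [ha]; ring
  rw [hb, hm]
  have hint : IntervalIntegrable (fun t : ℝ => remainderQuot m t) MeasureTheory.volume a (a + 2 * x) :=
    ((continuousOn_remainderQuot m).mono fun t ht => by
      rw [Set.uIcc_of_le (by linarith)] at ht
      exact ha0.trans ht.1).intervalIntegrable
  have e : 2 * x * remainderQuot m ((a + x : ℝ) : ℂ)
      = ∫ t in a..(a + 2 * x), remainderQuot m ((a + x : ℝ) : ℂ) := by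
    rw [intervalIntegral.integral_const, Complex.real_smul]; push_cast; ring
  rw [e, ← intervalIntegral.integral_sub hint intervalIntegrable_const]
  have key := intervalIntegral.norm_integral_le_of_norm_le_const
    (a := a) (b := a + 2 * x) (C := C / (1 + a) ^ 2 * x)
    (f := fun t : ℝ => remainderQuot m t - remainderQuot m ((a + x : ℝ) : ℂ)) ?_
  · refine key.trans (le_of_eq ?_)
    rw [add_sub_cancel_left, abs_of_pos (by linarith)]
    ring
  · intro t ht
    rw [Set.uIoc_of_le (by linarith)] at ht
    refine (norm_remainderQuot_sub_le hC hC0 ha0 (b := a + 2 * x) ⟨ht.1.le, ht.2⟩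
      ⟨by linarith, by linarith⟩).trans ?_
    gcongr
    rw [abs_le]; constructor <;> linarith [ht.1, ht.2]

/-- The midpoint sums of `centeredRemainder m t / t` with step `2 x` converge to the integral, with
error `O(x)`. -/
theorem exists_norm_midpoint_sum_sub_le (m : ℕ) : ∃ C : ℝ, ∀ x : ℝ, 0 < x → x ≤ 1 → ∀ S : ℂ,
    HasSum (fun i : ℕ => 2 * x * remainderQuot m ((2 * i + 1) * x : ℝ)) S →
    ‖deriv riemannZeta (-m) - S‖ ≤ C * x := by
  obtain ⟨C, hC0, hC⟩ := exists_norm_deriv_remainderQuot_le m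
  refine ⟨3 * C, fun x hx hx1 S hS => ?_⟩
  have h2x : 0 < 2 * x := by linarith
  obtain ⟨hint, hval⟩ := integrableOn_remainderQuot_and_integral m
  have t1 : Tendsto (fun N : ℕ => ∫ t in (0 : ℝ)..(N * (2 * x)), remainderQuot m t) atTop
      (nhds (deriv riemannZeta (-m))) := by
    rw [← hval]
    exact MeasureTheory.intervalIntegral_tendsto_integral_Ioi 0 hint
      (tendsto_natCast_atTop_atTop.atTop_mul_const h2x)
  have e1 : ∀ N : ℕ, ∫ t in (0 : ℝ)..(N * (2 * x)), remainderQuot m t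
      = ∑ i ∈ Finset.range N, ∫ t in (i * (2 * x))..((i + 1 : ℕ) * (2 * x)), remainderQuot m t := by
    intro N
    have := intervalIntegral.sum_integral_adjacent_intervals
      (μ := MeasureTheory.volume) (f := fun t : ℝ => remainderQuot m t)
      (a := fun k : ℕ => (k : ℝ) * (2 * x)) (n := N) ?_
    · rw [this]; simp
    · intro k _
      refine ((continuousOn_remainderQuot m).mono fun t ht => ?_).intervalIntegrable
      rw [Set.uIcc_of_le (by gcongr; omega)] at ht
      exact (by positivity : (0 : ℝ) ≤ k * (2 * x)).trans ht.1
  have t2 := t1.sub hS.tendsto_sum_nat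
  simp_rw [e1, ← Finset.sum_sub_distrib] at t2
  refine le_of_tendsto t2.norm (Eventually.of_forall fun N => ?_)
  refine (norm_sum_le _ _).trans ((Finset.sum_le_sum fun i _ =>
    norm_midpoint_error_le hC hC0 hx i).trans ?_)
  rw [← Finset.mul_sum]
  calc _ ≤ 2 * C * x ^ 2 * ((1 + 2 * x) / (2 * x)) := by
        gcongr; exact sum_inv_one_add_mul_sq_le h2x N
    _ = C * x * (1 + 2 * x) := by field_simp
    _ ≤ C * x * 3 := by gcongr; linarith
    _ = _ := by ring

/-! ### Expansion of the logarithm of the generating function at `z = 0` -/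

/-- The coefficient of `z^{-(m+1)}` in the expansion of `logGen m z` at `z = 0`. -/
noncomputable def leadCoeff (m : ℕ) : ℝ :=
  2 * m.factorial * ∑' j : ℕ, 1 / (2 * (j : ℝ) + 1) ^ (m + 2)

theorem summable_inv_odd_pow (m : ℕ) : Summable fun j : ℕ => 1 / (2 * (j : ℝ) + 1) ^ (m + 2) := by
  have h := (Real.summable_one_div_nat_pow (p := m + 2)).mpr (by omega)
  refine (h.comp_injective (i := fun j : ℕ => 2 * j + 1) fun a b h => by
    simp only at h; omega).congr fun j => ?_
  simp

/-- What is left of `logGen m z` after its leading term is removed. -/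
noncomputable def logRemainder (m : ℕ) (z : ℂ) : ℂ := logGen m z - leadCoeff m / z ^ (m + 1)

theorem odd_mul_re (j : ℕ) (z : ℂ) : ((2 * j + 1 : ℂ) * z).re = (2 * j + 1) * z.re := by
  have : (2 * j + 1 : ℂ) = ((2 * j + 1 : ℝ) : ℂ) := by push_cast; rfl
  rw [this, Complex.re_ofReal_mul]

theorem hasSum_logGen_odd (m : ℕ) {z : ℂ} (hz : 0 < z.re) :
    HasSum (fun j : ℕ => 2 / (2 * j + 1 : ℂ) * expPowerSum m ((2 * j + 1) * z)) (logGen m z) := by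
  have h := (summable_norm_logTerm m hz).of_norm.hasSum
  rw [← (Equiv.prodComm ℕ ℕ).hasSum_iff] at h
  refine h.prod_fiberwise fun j => ?_
  have hw : 0 < ((2 * j + 1 : ℂ) * z).re := by rw [odd_mul_re]; positivity
  convert! (hasSum_expPowerSum m hw).mul_left (2 / (2 * j + 1 : ℂ)) using 2 with k
  simp only [Function.comp_apply, Equiv.prodComm_apply, Prod.swap_prod_mk, logTerm]
  rw [mul_assoc (k + 1 : ℂ)]
  ring

theorem hasSum_logRemainder (m : ℕ) {z : ℂ} (hz : 0 < z.re) :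
    HasSum (fun j : ℕ => 2 / (2 * j + 1 : ℂ) * polyRemainder m ((2 * j + 1) * z))
      (logRemainder m z) := by
  have h0 : z ≠ 0 := fun h => by simp [h] at hz
  have h1 := (summable_inv_odd_pow m).hasSum.mul_left (2 * (m.factorial : ℝ))
  have h2 := (Complex.hasSum_ofReal.mpr h1).div_const (z ^ (m + 1))
  rw [logRemainder, leadCoeff]
  convert! (hasSum_logGen_odd m hz).sub h2 using 2 with j
  have hj : (2 * j + 1 : ℂ) ≠ 0 := by exact_mod_cast Nat.succ_ne_zero (2 * j)
  rw [polyRemainder_of_re_pos m (by rw [odd_mul_re]; positivity)]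
  push_cast
  rw [mul_pow]
  field_simp
  ring

/-- In the sector `|y| ≤ 2 π x` the remainder stays close to its value at `x = Re z`, uniformly as
`x → 0`. -/
theorem exists_norm_logRemainder_sub_le (m : ℕ) : ∃ C : ℝ, 0 ≤ C ∧ ∀ x y : ℝ, 0 < x → x ≤ 1 →
    |y| ≤ 2 * Real.pi * x →
    ‖logRemainder m (x + y * Complex.I) - logRemainder m x‖ ≤ C * (|y| / x) := by
  obtain ⟨C, hC0, hC⟩ := exists_norm_polyRemainder_le (m + 1)
  refine ⟨3 * C, by positivity, fun x y hx hx1 hy => ?_⟩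
  have h1 := hasSum_logRemainder m (z := x + y * Complex.I) (by simpa using hx)
  have h2 := hasSum_logRemainder m (z := x) (by simpa using hx)
  have h2x : 0 < 2 * x := by linarith
  have hb := ((summable_inv_one_add_mul_sq h2x).hasSum.mul_left (2 * C * |y|))
  rw [← (h1.sub h2).tsum_eq]
  refine (tsum_of_norm_bounded hb fun j => ?_).trans ?_
  · have hj : (0 : ℝ) < 2 * j + 1 := by positivity
    set a : ℝ := (2 * j + 1) * x with ha
    have ha0 : 0 < a := by positivity
    -- Mean value inequality on a vertical segment inside the sector; the factor `2 j + 1` from the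
    -- length of the segment cancels the coefficient `2 / (2 j + 1)`.
    have hconv : Convex ℝ {w : ℂ | w.re = a ∧ -(2 * Real.pi * a) ≤ w.im ∧ w.im ≤ 2 * Real.pi * a} := by
      have c1 : Convex ℝ {w : ℂ | w.re = a} := by
        have e : {w : ℂ | w.re = a} = {w | a ≤ w.re} ∩ {w | w.re ≤ a} := by
          ext w; exact ⟨fun h => ⟨h.ge, h.le⟩, fun h => le_antisymm h.2 h.1⟩
        rw [e]; exact (convex_halfSpace_re_ge _).inter (convex_halfSpace_re_le _)
      exact c1.inter ((convex_halfSpace_im_ge _).inter (convex_halfSpace_im_le _))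
    have key := hconv.norm_image_sub_le_of_norm_hasDerivWithin_le (C := C / (1 + a) ^ 2)
      (f := polyRemainder m) (f' := fun w => -polyRemainder (m + 1) w)
      (x := (2 * j + 1 : ℂ) * x) (y := (2 * j + 1 : ℂ) * (x + y * Complex.I)) ?_ ?_ ?_ ?_
    · rw [← mul_sub, norm_mul]
      have e1 : ‖(2 / (2 * j + 1) : ℂ)‖ = 2 / (2 * j + 1) := by
        rw [show (2 / (2 * j + 1) : ℂ) = ((2 / (2 * j + 1) : ℝ) : ℂ) by push_cast; rfl,
          Complex.norm_real, Real.norm_of_nonneg (by positivity)]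
      have e2 : ‖(2 * j + 1 : ℂ) * (x + y * Complex.I) - (2 * j + 1 : ℂ) * x‖
          = (2 * j + 1) * |y| := by
        rw [← mul_sub, add_sub_cancel_left, show (2 * j + 1 : ℂ) = ((2 * j + 1 : ℝ) : ℂ) by
          push_cast; rfl, norm_mul, norm_mul, Complex.norm_real, Complex.norm_real, Complex.norm_I,
          Real.norm_of_nonneg hj.le, mul_one, Real.norm_eq_abs]
      rw [e2] at key
      rw [e1]
      calc _ ≤ 2 / (2 * j + 1) * (C / (1 + a) ^ 2 * ((2 * j + 1) * |y|)) := by gcongr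
        _ = 2 * C * |y| * (1 / (1 + a) ^ 2) := by field_simp
        _ ≤ _ := by
          gcongr
          rw [ha]; nlinarith
    · intro w hw
      exact (hasDerivAt_polyRemainder m (expQuot_ne_zero_of_re_pos
        (by rw [hw.1]; exact ha0))).hasDerivWithinAt
    · intro w hw
      have hwn : a ≤ ‖w‖ := by rw [← hw.1]; exact Complex.re_le_norm w
      have him : |w.im| ≤ 2 * Real.pi * a := abs_le.mpr hw.2
      rw [norm_neg]
      refine (hC w (Or.inr ?_)).trans ?_
      · refine (Complex.norm_le_abs_re_add_abs_im w).trans ?_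
        rw [hw.1, abs_of_pos ha0]
        nlinarith [Real.pi_lt_d2]
      · refine div_le_div_of_nonneg_left hC0 (by positivity) ?_
        calc (1 + a) ^ 2 ≤ (1 + a) ^ (m + 1 + 1) :=
              pow_le_pow_right₀ (by linarith) (by omega)
          _ ≤ _ := by gcongr
    · have e : ((2 * j + 1 : ℂ) * x) = ((a : ℝ) : ℂ) := by rw [ha]; push_cast; rfl
      rw [e]
      simp only [Set.mem_ofPred_eq, Complex.ofReal_re, Complex.ofReal_im, true_and]
      constructor <;> nlinarith [Real.pi_pos]
    · have e : ((2 * j + 1 : ℂ) * (x + y * Complex.I))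
          = ((a : ℝ) : ℂ) + (((2 * j + 1) * y : ℝ) : ℂ) * Complex.I := by rw [ha]; push_cast; ring
      rw [e]
      have hy' := abs_le.mp hy
      simp only [Set.mem_ofPred_eq, Complex.add_re, Complex.ofReal_re, Complex.re_ofReal_mul,
        Complex.I_re, Complex.add_im, Complex.ofReal_im, Complex.im_ofReal_mul, Complex.I_im,
        mul_zero, add_zero, mul_one, zero_add, true_and]
      rw [ha]
      constructor <;> nlinarith
  · calc _ ≤ 2 * C * |y| * ((1 + 2 * x) / (2 * x)) := by
          gcongr; exact tsum_inv_one_add_mul_sq_le h2x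
      _ = C * (|y| / x) * (1 + 2 * x) := by field_simp
      _ ≤ C * (|y| / x) * 3 := by gcongr; linarith
      _ = _ := by ring

theorem logRatio_ofReal {t : ℝ} (ht : |t| < 1) :
    logRatio t = ((Real.log (1 + t) - Real.log (1 - t) : ℝ) : ℂ) := by
  have h := abs_lt.mp ht
  rw [logRatio, Complex.ofReal_sub, Complex.ofReal_log (by linarith),
    Complex.ofReal_log (by linarith)]
  push_cast; rfl

theorem tendsto_logRatio_exp_neg :
    Tendsto (fun x : ℝ => logRatio (Complex.exp (-x)) + ((Real.log (x / 2) : ℝ) : ℂ))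
      (nhdsWithin 0 (Set.Ioi 0)) (nhds 0) := by
  have h1 : Tendsto (fun x : ℝ => (1 - Real.exp (-x)) / x) (nhdsWithin 0 (Set.Ioi 0)) (nhds 1) := by
    have : HasDerivAt (fun x : ℝ => 1 - Real.exp (-x)) 1 0 := by
      convert! ((hasDerivAt_neg (0 : ℝ)).exp).const_sub 1 using 1; simp
    have := (hasDerivAt_iff_tendsto_slope.mp this).mono_left
      (nhdsWithin_mono 0 fun t (ht : 0 < t) => ht.ne')
    refine this.congr fun x => ?_
    rw [slope_def_field]; simp
  have h2 := (Real.continuousAt_log one_ne_zero).tendsto.comp h1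
  have h3 : Tendsto (fun x : ℝ => Real.log (1 + Real.exp (-x))) (nhdsWithin 0 (Set.Ioi 0))
      (nhds (Real.log 2)) := by
    have : Continuous fun x : ℝ => Real.log (1 + Real.exp (-x)) :=
      Continuous.log (by fun_prop) fun x => by positivity
    refine (this.tendsto' 0 _ ?_).mono_left nhdsWithin_le_nhds
    norm_num
  have h4 := (h3.sub h2).sub_const (Real.log 2)
  rw [Real.log_one, sub_zero, sub_self] at h4
  have h5 := (Complex.continuous_ofReal.tendsto _).comp h4
  rw [Complex.ofReal_zero] at h5
  refine h5.congr' ?_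
  filter_upwards [self_mem_nhdsWithin] with x hx
  have hx0 : (0 : ℝ) < x := hx
  have he : Real.exp (-x) < 1 := by simpa using hx0
  simp only [Function.comp_apply]
  rw [show Complex.exp (-x) = ((Real.exp (-x) : ℝ) : ℂ) by push_cast; rfl,
    logRatio_ofReal (by rwa [abs_of_pos (Real.exp_pos _)]), ← Complex.ofReal_add,
    Real.log_div (by linarith) hx0.ne', Real.log_div hx0.ne' two_ne_zero]
  congr 1; ring

/-- On the real axis the remainder is `-ζ(-m) log (x / 2) + ζ'(-m) + o(1)`. -/
theorem tendsto_logRemainder (m : ℕ) :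
    Tendsto (fun x : ℝ => logRemainder m x + riemannZeta (-m) * ((Real.log (x / 2) : ℝ) : ℂ))
      (nhdsWithin 0 (Set.Ioi 0)) (nhds (deriv riemannZeta (-m))) := by
  obtain ⟨C, hC⟩ := exists_norm_midpoint_sum_sub_le m
  have hS : ∀ x : ℝ, 0 < x → HasSum (fun i : ℕ => 2 * x * remainderQuot m ((2 * i + 1) * x : ℝ))
      (logRemainder m x - riemannZeta (-m) * logRatio (Complex.exp (-x))) := by
    intro x hx
    have he : ‖Complex.exp (-x)‖ < 1 := by rw [Complex.norm_exp]; simpa using hx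
    convert! (hasSum_logRemainder m (z := x) (by simpa using hx)).sub
      ((hasSum_logRatio he).mul_left (riemannZeta (-m))) using 2 with i
    have hx' : (x : ℂ) ≠ 0 := by exact_mod_cast hx.ne'
    have hi : (2 * i + 1 : ℂ) ≠ 0 := by exact_mod_cast Nat.succ_ne_zero (2 * i)
    push_cast
    rw [remainderQuot_of_ne m (mul_ne_zero hi hx'), centeredRemainder, polyRemainder_zero,
      ← Complex.exp_nat_mul]
    push_cast
    rw [mul_neg]
    field_simp
  have t1 : Tendsto (fun x : ℝ => deriv riemannZeta (-m) - (logRemainder m x -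
      riemannZeta (-m) * logRatio (Complex.exp (-x)))) (nhdsWithin 0 (Set.Ioi 0)) (nhds 0) := by
    refine squeeze_zero_norm' (a := fun x => C * x) ?_ ?_
    · filter_upwards [Ioc_mem_nhdsGT one_pos] with x hx
      exact hC x hx.1 hx.2 _ (hS x hx.1)
    · exact ((continuous_const_mul C).tendsto' 0 0 (by simp)).mono_left nhdsWithin_le_nhds
  -- The multiple of `e^{-w}` taken out of the remainder sums to `ζ(-m)` times `logRatio`.
  have t2 := (tendsto_logRatio_exp_neg.const_mul (riemannZeta (-m))).sub t1
  have t3 := t2.add_const (deriv riemannZeta (-m))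
  simp only [mul_zero, sub_zero, zero_add] at t3
  refine t3.congr fun x => ?_
  ring

/-! ### Minor arcs -/

/-- The cosines form a geometric sum, bounded by `2 / |e^{iy} - 1| ≤ π / |y|`. -/
theorem sum_one_sub_cos_ge {y : ℝ} (hy0 : y ≠ 0) (hy : |y| ≤ Real.pi) (N : ℕ) :
    N - Real.pi / |y| ≤ ∑ i ∈ Finset.range N, (1 - Real.cos ((N + i) * y)) := by
  have hpos : 0 < |y| := abs_pos.mpr hy0
  set w : ℂ := Complex.exp (Complex.I * y) with hw
  have hwn : ‖w‖ = 1 := by rw [hw, Complex.norm_exp]; simp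
  have hlow : 2 * |y| / Real.pi ≤ ‖w - 1‖ := by
    rw [hw, Complex.norm_exp_I_mul_ofReal_sub_one, norm_mul, Real.norm_eq_abs, Real.norm_eq_abs,
      abs_two]
    have h1 := Real.mul_le_sin (x := |y| / 2) (by positivity) (by linarith)
    have h2 : Real.sin (|y| / 2) ≤ |Real.sin (y / 2)| := by
      rcases abs_choice y with h | h
      · rw [h]; exact le_abs_self _
      · rw [h, neg_div, Real.sin_neg]; exact neg_le_abs _
    calc 2 * |y| / Real.pi = 2 * (2 / Real.pi * (|y| / 2)) := by ring
      _ ≤ _ := by linarith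
  have hlow0 : 0 < 2 * |y| / Real.pi := by positivity
  have hw1 : w ≠ 1 := fun h => by rw [h] at hlow; simp at hlow; linarith
  have e : ∀ i : ℕ, Real.cos ((N + i) * y) = (w ^ N * w ^ i).re := fun i => by
    rw [← pow_add, hw, ← Complex.exp_nat_mul,
      show ((N + i : ℕ) : ℂ) * (Complex.I * y) = (((N + i) * y : ℝ) : ℂ) * Complex.I by
        push_cast; ring, Complex.exp_ofReal_mul_I_re]
  have hb : ‖∑ i ∈ Finset.range N, w ^ N * w ^ i‖ ≤ Real.pi / |y| := by
    rw [← Finset.mul_sum, norm_mul, norm_pow, hwn, one_pow, one_mul, geom_sum_eq hw1, norm_div]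
    have h3 : ‖w ^ N - 1‖ ≤ 2 := by
      refine (norm_sub_le _ _).trans ?_
      rw [norm_pow, hwn]; norm_num
    calc _ ≤ 2 / (2 * |y| / Real.pi) := by gcongr
      _ = _ := by field_simp
  rw [Finset.sum_sub_distrib]
  simp only [Finset.sum_const, Finset.card_range, nsmul_eq_mul, mul_one]
  simp_rw [e]
  rw [← Complex.re_sum]
  linarith [Complex.re_le_norm (∑ i ∈ Finset.range N, w ^ N * w ^ i)]

theorem re_logTerm (m : ℕ) (x y : ℝ) (p : ℕ × ℕ) :
    (logTerm m (x + y * Complex.I) p).re = 2 * (p.1 + 1) ^ m / (2 * p.2 + 1)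
      * Real.exp (-((p.1 + 1) * (2 * p.2 + 1) * x)) * Real.cos ((p.1 + 1) * (2 * p.2 + 1) * y) := by
  have e : logTerm m (x + y * Complex.I) p = ((2 * (p.1 + 1) ^ m / (2 * p.2 + 1) : ℝ) : ℂ)
      * Complex.exp (((-((p.1 + 1) * (2 * p.2 + 1) * x) : ℝ) : ℂ)
        + ((-((p.1 + 1) * (2 * p.2 + 1) * y) : ℝ) : ℂ) * Complex.I) := by
    rw [logTerm]; push_cast; congr 2; ring
  rw [e, Complex.re_ofReal_mul, Complex.exp_re]
  simp
  ring

/-- On the minor arcs the generating function is exponentially smaller than on the positive axis: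
it suffices to look at the terms with `j = 1` and `k` of size about `1 / x`. -/
theorem re_logGen_le_of_minor (m : ℕ) {x y : ℝ} (hx : 0 < x) (hx1 : x ≤ 1)
    (hy1 : 2 * Real.pi * x ≤ |y|) (hy2 : |y| ≤ Real.pi) :
    (logGen m (x + y * Complex.I)).re ≤ (logGen m x).re - Real.exp (-4) * (1 / x ^ (m + 1)) := by
  -- With `N = M + 1 = ⌈1 / x⌉`, the terms `N ≤ k < 2 N` are used: there `k x ≤ 4`, and the cosines
  -- sum to at most `π / |y| ≤ N / 2`.
  obtain ⟨M, hM⟩ : ∃ M, ⌈1 / x⌉₊ = M + 1 :=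
    Nat.exists_eq_succ_of_ne_zero (Nat.ceil_pos.mpr (by positivity)).ne'
  have hN1 : 1 / x ≤ M + 1 := by
    have := Nat.le_ceil (1 / x); rw [hM] at this; exact_mod_cast this
  have hN2 : ((M : ℝ) + 1) * x ≤ 2 := by
    have := (Nat.ceil_lt_add_one (a := 1 / x) (by positivity)).le
    rw [hM] at this; push_cast at this
    calc ((M : ℝ) + 1) * x ≤ (1 / x + 1) * x := by gcongr
      _ = 1 + x := by field_simp
      _ ≤ 2 := by linarith
  have hy0 : y ≠ 0 := by
    rintro rfl
    simp at hy1
    nlinarith [mul_pos Real.pi_pos hx]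
  have hre : ∀ y : ℝ, 0 < ((x : ℂ) + y * Complex.I).re := fun y => by simpa using hx
  have s1 := (Complex.hasSum_re (summable_norm_logTerm m (hre 0)).of_norm.hasSum).sub
    (Complex.hasSum_re (summable_norm_logTerm m (hre y)).of_norm.hasSum)
  have hnn : ∀ p : ℕ × ℕ, 0 ≤ (logTerm m (x + (0 : ℝ) * Complex.I) p).re
      - (logTerm m (x + y * Complex.I) p).re := fun p => by
    rw [re_logTerm, re_logTerm, ← mul_sub, mul_zero, Real.cos_zero]
    exact mul_nonneg (by positivity) (sub_nonneg.mpr (Real.cos_le_one _))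
  have inj : Function.Injective fun i : ℕ => ((M + i, 0) : ℕ × ℕ) := fun a b h => by
    simpa using h
  have s2 := sum_le_hasSum ((Finset.range (M + 1)).map ⟨_, inj⟩) (fun p _ => hnn p) s1
  rw [Finset.sum_map] at s2
  simp only [Function.Embedding.coeFn_mk] at s2
  have hcos := sum_one_sub_cos_ge hy0 hy2 (M + 1)
  have hpi : Real.pi / |y| ≤ (M + 1) / 2 := by
    rw [div_le_iff₀ (abs_pos.mpr hy0)]
    rw [div_le_iff₀ hx] at hN1
    nlinarith [Real.pi_pos]
  have hlow : ((M : ℝ) + 1) ^ m * Real.exp (-4) * (M + 1) ≤ ∑ i ∈ Finset.range (M + 1),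
      ((logTerm m (x + (0 : ℝ) * Complex.I) (M + i, 0)).re
        - (logTerm m (x + y * Complex.I) (M + i, 0)).re) := by
    calc ((M : ℝ) + 1) ^ m * Real.exp (-4) * (M + 1)
        ≤ 2 * ((M : ℝ) + 1) ^ m * Real.exp (-4) *
          ∑ i ∈ Finset.range (M + 1), (1 - Real.cos (((M + 1 : ℕ) + i) * y)) := by
          have : ((M : ℝ) + 1) / 2 ≤ ∑ i ∈ Finset.range (M + 1),
            (1 - Real.cos (((M + 1 : ℕ) + i) * y)) := by
            refine le_trans ?_ hcos; push_cast; linarith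
          calc _ = 2 * ((M : ℝ) + 1) ^ m * Real.exp (-4) * ((M + 1) / 2) := by ring
            _ ≤ _ := by gcongr
      _ ≤ _ := by
          rw [Finset.mul_sum]
          refine Finset.sum_le_sum fun i hi => ?_
          have hi' : (i : ℝ) ≤ M := by
            exact_mod_cast Nat.lt_succ_iff.mp (Finset.mem_range.mp hi)
          rw [re_logTerm, re_logTerm, ← mul_sub, mul_zero, Real.cos_zero]
          push_cast
          simp only [mul_zero, zero_add, mul_one, div_one]
          have hc := sub_nonneg.mpr (Real.cos_le_one (((M : ℝ) + 1 + i) * y))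
          rw [show ((M : ℝ) + i + 1) = M + 1 + i by ring]
          refine mul_le_mul_of_nonneg_right (mul_le_mul (mul_le_mul_of_nonneg_left
            (pow_le_pow_left₀ (by positivity) (by linarith [i.cast_nonneg (α := ℝ)]) m) two_pos.le)
            (Real.exp_le_exp.mpr ?_) (Real.exp_pos _).le (by positivity)) hc
          nlinarith
  have hpow : Real.exp (-4) * (1 / x ^ (m + 1)) ≤ ((M : ℝ) + 1) ^ m * Real.exp (-4) * (M + 1) := by
    rw [show ((M : ℝ) + 1) ^ m * Real.exp (-4) * (M + 1) = Real.exp (-4) * ((M : ℝ) + 1) ^ (m + 1) by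
      ring, ← one_div_pow]
    gcongr
  have e0 : ((x : ℂ) + (0 : ℝ) * Complex.I) = x := by simp
  simp only [e0] at s2 hlow
  rw [logGen, logGen]
  linarith

/-! ### Laplace's method on the major arc -/

theorem continuous_logGen_vertical (m : ℕ) {x : ℝ} (hx : 0 < x) :
    Continuous fun y : ℝ => logGen m (x + y * Complex.I) := by
  have hs := summable_norm_logTerm m (z := x) (by simpa using hx)
  refine continuous_tsum (fun p => ?_) hs fun p y => ?_
  · unfold logTerm; fun_prop
  · rw [norm_logTerm, norm_logTerm]; simp

/-- A form of Taylor's formula for `v ↦ v^(-p)` at `v = 1` with exact quadratic remainder. -/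
theorem inv_pow_sub_one_add_mul {v : ℂ} (hv : v ≠ 0) (p : ℕ) :
    (v ^ p)⁻¹ - 1 + p * (v - 1)
      = (v - 1) ^ 2 * ∑ k ∈ Finset.range p, ∑ l ∈ Finset.range (k + 1), (v ^ (l + 1))⁻¹ := by
  have h1 : ∀ p : ℕ, 1 - (v ^ p)⁻¹ = (v - 1) * ∑ l ∈ Finset.range p, (v ^ (l + 1))⁻¹ := by
    intro p
    induction p with
    | zero => simp
    | succ p ih =>
      rw [Finset.sum_range_succ, mul_add, ← ih]
      field_simp
      ring
  induction p with
  | zero => simp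
  | succ p ih =>
    rw [Finset.sum_range_succ, mul_add, ← ih, sq, mul_assoc (v - 1) (v - 1), ← h1 (p + 1), mul_sub,
      mul_one]
    field_simp
    push_cast
    ring

theorem tendsto_sum_inv_pow (p : ℕ) : Tendsto (fun u : ℝ => ∑ k ∈ Finset.range p,
    ∑ l ∈ Finset.range (k + 1), (((1 : ℂ) + u * Complex.I) ^ (l + 1))⁻¹) (nhds 0)
    (nhds ((p * (p + 1) / 2 : ℝ) : ℂ)) := by
  have e : ((p * (p + 1) / 2 : ℝ) : ℂ) = ∑ k ∈ Finset.range p,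
      ∑ l ∈ Finset.range (k + 1), (((1 : ℂ) + (0 : ℝ) * Complex.I) ^ (l + 1))⁻¹ := by
    simp only [Complex.ofReal_zero, zero_mul, add_zero, one_pow, inv_one, Finset.sum_const,
      Finset.card_range, nsmul_eq_mul, mul_one]
    induction p with
    | zero => simp
    | succ p ih => rw [Finset.sum_range_succ, ← ih]; push_cast; ring
  rw [e]
  refine tendsto_finsetSum _ fun k _ => tendsto_finsetSum _ fun l _ => ?_
  refine Tendsto.inv₀ ?_ (by simp)
  exact ((by fun_prop : Continuous fun u : ℝ => ((1 : ℂ) + u * Complex.I) ^ (l + 1))).tendsto 0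

theorem leadCoeff_pos (m : ℕ) : 0 < leadCoeff m :=
  mul_pos (by positivity) ((summable_inv_odd_pow m).tsum_pos (fun _ => by positivity) 0 (by simp))

theorem logGen_sub_logGen (m : ℕ) {x : ℝ} (hx : 0 < x) (u : ℝ) :
    logGen m (x + (x * u : ℝ) * Complex.I) - logGen m x
      = ((leadCoeff m / x ^ (m + 1) : ℝ) : ℂ) * (((1 + u * Complex.I) ^ (m + 1))⁻¹ - 1)
        + (logRemainder m (x + (x * u : ℝ) * Complex.I) - logRemainder m x) := by
  have hx' : (x : ℂ) ≠ 0 := by exact_mod_cast hx.ne'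
  rw [logRemainder, logRemainder, show (x : ℂ) + (x * u : ℝ) * Complex.I = x * (1 + u * Complex.I) by
    push_cast; ring, mul_pow]
  push_cast
  rw [div_eq_mul_inv, div_eq_mul_inv, mul_inv]
  ring

theorem re_inv_pow_sub_one_le (m : ℕ) {u : ℝ} (hu : |u| ≤ 2 * Real.pi) :
    (((1 + u * Complex.I : ℂ) ^ (m + 1))⁻¹ - 1).re ≤ -(u ^ 2 / 72) := by
  have hn : ‖(1 + u * Complex.I : ℂ)‖ = Real.sqrt (1 + u ^ 2) := by
    have := Complex.norm_add_mul_I 1 u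
    simpa using this
  set v := Real.sqrt (1 + u ^ 2) with hv
  have hv2 : v ^ 2 = 1 + u ^ 2 := Real.sq_sqrt (by positivity)
  have hv0 : 0 ≤ v := Real.sqrt_nonneg _
  have hv1 : 1 ≤ v := by nlinarith [sq_nonneg u]
  have hv8 : v ≤ 8 := by
    have : u ^ 2 ≤ 7 ^ 2 := by
      rw [← sq_abs u]; gcongr; linarith [Real.pi_lt_d2]
    nlinarith
  have h1 : (((1 + u * Complex.I : ℂ) ^ (m + 1))⁻¹).re ≤ v⁻¹ := by
    refine (Complex.re_le_norm _).trans ?_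
    rw [norm_inv, norm_pow, hn]
    exact inv_anti₀ (by linarith) (le_self_pow₀ hv1 (by omega))
  have h2 : v⁻¹ ≤ 1 - u ^ 2 / 72 := by
    rw [inv_le_iff_one_le_mul₀ (by linarith)]
    nlinarith [mul_nonneg (sub_nonneg.mpr hv1) (sub_nonneg.mpr hv8), mul_nonneg hv0 (mul_nonneg (sub_nonneg.mpr hv1) (sub_nonneg.mpr hv8))]
  rw [Complex.sub_re, Complex.one_re]
  linarith

/-- The generating function on a vertical line, relative to its value on the real axis, is
dominated by a rescaled Cauchy density. -/
theorem exists_exp_re_logGen_sub_le (m : ℕ) : ∃ K : ℝ, 0 ≤ K ∧ ∀ x y : ℝ, 0 < x → x ≤ 1 →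
    |y| ≤ Real.pi → Real.exp (logGen m (x + y * Complex.I) - logGen m x).re
      * (1 + (y / x) ^ 2 * (leadCoeff m / x ^ (m + 1))) ≤ K := by
  obtain ⟨C, hC0, hC⟩ := exists_norm_logRemainder_sub_le m
  have hA := leadCoeff_pos m
  set c := Real.exp (-4) with hc
  have hc0 : 0 < c := Real.exp_pos _
  refine ⟨72 * Real.exp (C * (2 * Real.pi)) + (1 + Real.pi ^ 2 * leadCoeff m * (6 / c ^ 3)),
    by positivity, fun x y hx hx1 hy => ?_⟩
  have hxm : 0 < x ^ (m + 1) := by positivity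
  rcases le_or_gt |y| (2 * Real.pi * x) with h | h
  · set u := y / x with hu
    have hyu : y = x * u := by rw [hu]; field_simp
    have hau : |y| / x = |u| := by rw [hu, abs_div, abs_of_pos hx]
    have hu1 : |u| ≤ 2 * Real.pi := by rw [← hau, div_le_iff₀ hx]; exact h
    set L := leadCoeff m / x ^ (m + 1) with hL
    have hL0 : 0 < L := by positivity
    have h1 : (logGen m (x + y * Complex.I) - logGen m x).re
        ≤ -(L * u ^ 2 / 72) + C * (2 * Real.pi) := by
      have h2 := hC x y hx hx1 h
      rw [hau] at h2
      rw [hyu] at h2 ⊢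
      rw [logGen_sub_logGen m hx, Complex.add_re, Complex.re_ofReal_mul]
      have h3 := mul_le_mul_of_nonneg_left (re_inv_pow_sub_one_le m hu1) hL0.le
      have h4 := (Complex.re_le_norm _).trans h2
      have h5 : C * |u| ≤ C * (2 * Real.pi) := by gcongr
      refine add_le_add (h3.trans (le_of_eq (by ring))) (h4.trans h5)
    -- The factor `1 + L u²` is absorbed by the Gaussian decay `exp (-L u² / 72)`.
    have h6 : 1 + u ^ 2 * L ≤ 72 * Real.exp (L * u ^ 2 / 72) := by
      have := Real.add_one_le_exp (L * u ^ 2 / 72)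
      linarith
    calc _ ≤ Real.exp (-(L * u ^ 2 / 72) + C * (2 * Real.pi)) *
          (72 * Real.exp (L * u ^ 2 / 72)) := by gcongr
      _ = 72 * Real.exp (C * (2 * Real.pi)) := by
          rw [Real.exp_add, Real.exp_neg]; field_simp
      _ ≤ _ := by linarith [show 0 ≤ 1 + Real.pi ^ 2 * leadCoeff m * (6 / c ^ 3) by positivity]
  · have h1 := re_logGen_le_of_minor m hx hx1 h.le hy
    set X := 1 / x ^ (m + 1) with hX
    have hX0 : 0 < X := by positivity
    have h2 : 1 / x ≤ X := one_div_le_one_div_of_le hxm (pow_le_of_le_one hx.le hx1 (by omega))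
    have h3 : (y / x) ^ 2 * (leadCoeff m / x ^ (m + 1)) ≤ Real.pi ^ 2 * leadCoeff m * X ^ 3 := by
      calc (y / x) ^ 2 * (leadCoeff m / x ^ (m + 1)) = |y| ^ 2 * leadCoeff m * ((1 / x) ^ 2 * X) := by
            rw [hX, sq_abs]; field_simp
        _ ≤ Real.pi ^ 2 * leadCoeff m * (X ^ 2 * X) := by gcongr
        _ = _ := by ring
    -- On the minor arcs the factor is at most cubic in `X`, which the exponential absorbs.
    have h4 : Real.exp (-(c * X)) * X ^ 3 ≤ 6 / c ^ 3 := by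
      have := Real.pow_div_factorial_le_exp (c * X) (by positivity) 3
      rw [Real.exp_neg, le_div_iff₀ (by positivity), inv_mul_eq_div, div_mul_eq_mul_div,
        div_le_iff₀ (Real.exp_pos _)]
      norm_num [Nat.factorial] at this
      nlinarith
    have h5 : Real.exp (-(c * X)) ≤ 1 := Real.exp_le_one_iff.mpr (by nlinarith)
    calc _ ≤ Real.exp (-(c * X)) * (1 + Real.pi ^ 2 * leadCoeff m * X ^ 3) := by
          gcongr
          rw [Complex.sub_re]; linarith
      _ = Real.exp (-(c * X)) + Real.pi ^ 2 * leadCoeff m * (Real.exp (-(c * X)) * X ^ 3) := by ring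
      _ ≤ 1 + Real.pi ^ 2 * leadCoeff m * (6 / c ^ 3) := by gcongr
      _ ≤ _ := by linarith [show 0 ≤ 72 * Real.exp (C * (2 * Real.pi)) by positivity]

/-- The integrand of Cauchy's formula at the saddle point `x`, divided by its value on the real
axis. The frequency is `n = (m + 1) A / x^(m+2)`, with `A` the leading coefficient. -/
noncomputable def saddleIntegrand (m : ℕ) (x y : ℝ) : ℂ :=
  Complex.exp (logGen m (x + y * Complex.I) - logGen m x
    + (((m + 1) * (leadCoeff m / x ^ (m + 1)) * (y / x) : ℝ) : ℂ) * Complex.I)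

theorem norm_saddleIntegrand (m : ℕ) (x y : ℝ) : ‖saddleIntegrand m x y‖
    = Real.exp (logGen m (x + y * Complex.I) - logGen m x).re := by
  rw [saddleIntegrand, Complex.norm_exp, Complex.add_re, Complex.re_ofReal_mul, Complex.I_re,
    mul_zero, add_zero]

/-- After rescaling to the width of the peak, the integrand tends to a Gaussian. -/
theorem tendsto_saddleIntegrand (m : ℕ) (t : ℝ) :
    Tendsto (fun x : ℝ => saddleIntegrand m x (x / Real.sqrt (leadCoeff m / x ^ (m + 1)) * t))
      (nhdsWithin 0 (Set.Ioi 0))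
      (nhds ((Real.exp (-((m + 1) * (m + 2) / 2) * t ^ 2) : ℝ) : ℂ)) := by
  obtain ⟨C, hC0, hC⟩ := exists_norm_logRemainder_sub_le m
  have hA := leadCoeff_pos m
  set L : ℝ → ℝ := fun x => leadCoeff m / x ^ (m + 1) with hL
  have hLtop : Tendsto L (nhdsWithin 0 (Set.Ioi 0)) atTop := by
    refine Tendsto.const_mul_atTop hA (Tendsto.inv_tendsto_nhdsGT_zero ?_)
    rw [tendsto_nhdsWithin_iff]
    refine ⟨((continuous_pow (m + 1)).tendsto' 0 0 (by simp)).mono_left nhdsWithin_le_nhds, ?_⟩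
    filter_upwards [self_mem_nhdsWithin] with x hx using pow_pos (Set.mem_Ioi.mp hx) _
  -- The relative height `u = y / x` tends to `0` while `L u² = t²` is fixed.
  set u : ℝ → ℝ := fun x => t / Real.sqrt (L x) with hu
  have hu0 : Tendsto u (nhdsWithin 0 (Set.Ioi 0)) (nhds 0) :=
    Tendsto.const_div_atTop (Real.tendsto_sqrt_atTop.comp hLtop) t
  have hsum := (tendsto_sum_inv_pow (m + 1)).comp hu0
  have h1 : Tendsto (fun x : ℝ => logRemainder m (x + (x * u x : ℝ) * Complex.I) - logRemainder m x)
      (nhdsWithin 0 (Set.Ioi 0)) (nhds 0) := by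
    refine squeeze_zero_norm' (a := fun x => C * |u x|) ?_ (by simpa using (hu0.abs).const_mul C)
    filter_upwards [Ioc_mem_nhdsGT one_pos,
      hu0.abs.eventually_lt_const (u := 2 * Real.pi) (by rw [abs_zero]; positivity)] with x hx hux
    have := hC x (x * u x) hx.1 hx.2 (by
      rw [abs_mul, abs_of_pos hx.1, mul_comm]; exact mul_le_mul_of_nonneg_right hux.le hx.1.le)
    rwa [abs_mul, abs_of_pos hx.1, mul_div_cancel_left₀ _ hx.1.ne'] at this
  have h2 := (hsum.const_mul (-(t : ℂ) ^ 2)).add h1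
  have h3 := (Complex.continuous_exp.tendsto _).comp h2
  have e : Complex.exp (-(t : ℂ) ^ 2 * ((((m + 1 : ℕ) : ℝ) * (((m + 1 : ℕ) : ℝ) + 1) / 2 : ℝ) : ℂ) + 0)
      = ((Real.exp (-((m + 1) * (m + 2) / 2) * t ^ 2) : ℝ) : ℂ) := by
    push_cast; congr 1; ring
  rw [e] at h3
  refine h3.congr' ?_
  filter_upwards [self_mem_nhdsWithin] with x hx
  have hx0 : (0 : ℝ) < x := hx
  have hLx : 0 < L x := by simp only [hL]; positivity
  have hs : 0 < Real.sqrt (L x) := Real.sqrt_pos.mpr hLx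
  have ey : x / Real.sqrt (leadCoeff m / x ^ (m + 1)) * t = x * u x := by
    simp only [hu, hL]; ring
  have hv : (1 + (u x : ℂ) * Complex.I) ≠ 0 := fun h => by
    have := congrArg Complex.re h; simp at this
  have et : ((t : ℂ)) ^ 2 = (L x : ℂ) * (u x : ℂ) ^ 2 := by
    have : t ^ 2 = L x * u x ^ 2 := by
      simp only [hu]; rw [div_pow, Real.sq_sqrt hLx.le]; field_simp
    exact_mod_cast this
  have key := inv_pow_sub_one_add_mul hv (m + 1)
  simp only [Function.comp_apply]
  rw [saddleIntegrand, ey, logGen_sub_logGen m hx0, mul_div_cancel_left₀ _ hx0.ne', et]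
  congr 1
  have hI : (1 + (u x : ℂ) * Complex.I - 1) ^ 2 = -(u x : ℂ) ^ 2 := by
    rw [add_sub_cancel_left, mul_pow, Complex.I_sq]; ring
  rw [hI] at key
  change _ = (L x : ℂ) * _ + _ + (((m + 1) * L x * u x : ℝ) : ℂ) * Complex.I
  push_cast at key ⊢
  linear_combination -(L x : ℂ) * key

/-- Laplace's method: the integral of the saddle point integrand, with the scale
`x / √(A / x^(m+1))` taken out. -/
theorem tendsto_integral_saddleIntegrand (m : ℕ) :
    Tendsto (fun x : ℝ => ((Real.sqrt (leadCoeff m / x ^ (m + 1)) / x : ℝ) : ℂ)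
        * ∫ y in (-Real.pi)..Real.pi, saddleIntegrand m x y)
      (nhdsWithin 0 (Set.Ioi 0))
      (nhds ((Real.sqrt (2 * Real.pi / ((m + 1) * (m + 2))) : ℝ) : ℂ)) := by
  obtain ⟨K, hK0, hK⟩ := exists_exp_re_logGen_sub_le m
  have hA := leadCoeff_pos m
  set s : ℝ → ℝ := fun x => x / Real.sqrt (leadCoeff m / x ^ (m + 1)) with hs
  have hspos : ∀ x, 0 < x → 0 < s x := fun x hx => by simp only [hs]; positivity
  set F : ℝ → ℝ → ℂ := fun x t =>
    (Set.Ioc (-Real.pi / s x) (Real.pi / s x)).indicator (fun t => saddleIntegrand m x (s x * t)) t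
    with hF
  have hcont : ∀ x, 0 < x → Continuous fun y => saddleIntegrand m x y := fun x hx => by
    unfold saddleIntegrand
    have := continuous_logGen_vertical m hx
    fun_prop
  have hs0 : Tendsto s (nhdsWithin 0 (Set.Ioi 0)) (nhds 0) := by
    have : ∀ᶠ x in nhdsWithin (0 : ℝ) (Set.Ioi 0), ‖s x‖ ≤ x / Real.sqrt (leadCoeff m) := by
      filter_upwards [Ioc_mem_nhdsGT one_pos] with x hx
      rw [Real.norm_of_nonneg (hspos x hx.1).le]
      have hx1 : x ^ (m + 1) ≤ 1 := pow_le_one₀ hx.1.le hx.2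
      have hxm : 0 < x ^ (m + 1) := pow_pos hx.1 _
      have : leadCoeff m ≤ leadCoeff m / x ^ (m + 1) := by
        rw [le_div_iff₀ hxm]; nlinarith
      simp only [hs]
      have h0 := Real.sqrt_pos.mpr hA
      have := hx.1.le
      gcongr
    exact squeeze_zero_norm' this
      ((continuous_id.div_const _).tendsto' 0 0 (by simp) |>.mono_left nhdsWithin_le_nhds)
  have key : Tendsto (fun x => ∫ t, F x t) (nhdsWithin 0 (Set.Ioi 0))
      (nhds (∫ t : ℝ, ((Real.exp (-((m + 1) * (m + 2) / 2) * t ^ 2) : ℝ) : ℂ))) := by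
    refine MeasureTheory.tendsto_integral_filter_of_dominated_convergence
      (fun t => K * (1 + t ^ 2)⁻¹) ?_ ?_ (integrable_inv_one_add_sq.const_mul K) ?_
    · filter_upwards [self_mem_nhdsWithin] with x hx
      exact (((hcont x hx).comp (continuous_const_mul (s x))).stronglyMeasurable.indicator
        measurableSet_Ioc).aestronglyMeasurable
    · filter_upwards [Ioc_mem_nhdsGT one_pos] with x hx
      refine Eventually.of_forall fun t => ?_
      have hsx := hspos x hx.1
      by_cases ht : t ∈ Set.Ioc (-Real.pi / s x) (Real.pi / s x)
      · simp only [hF, Set.indicator_of_mem ht]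
        have hy : |s x * t| ≤ Real.pi := by
          have h1 := ht.1
          have h2 := ht.2
          rw [div_lt_iff₀ hsx] at h1
          rw [le_div_iff₀ hsx] at h2
          rw [abs_le]; constructor <;> linarith
        have h3 := hK x (s x * t) hx.1 hx.2 hy
        have hL : 0 < leadCoeff m / x ^ (m + 1) := div_pos hA (pow_pos hx.1 _)
        have e : (s x * t / x) ^ 2 * (leadCoeff m / x ^ (m + 1)) = t ^ 2 := by
          have : s x * t / x = t / Real.sqrt (leadCoeff m / x ^ (m + 1)) := by
            simp only [hs]
            have := hx.1.ne'
            field_simp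
          rw [this, div_pow, Real.sq_sqrt hL.le, div_mul_cancel₀ _ hL.ne']
        rw [e] at h3
        rw [norm_saddleIntegrand, ← div_eq_mul_inv, le_div_iff₀ (by positivity)]
        exact h3
      · simp only [hF, Set.indicator_of_notMem ht, norm_zero]; positivity
    · refine Eventually.of_forall fun t => ?_
      refine (tendsto_saddleIntegrand m t).congr' ?_
      have h1 : Tendsto (fun x => s x * t) (nhdsWithin 0 (Set.Ioi 0)) (nhds 0) := by
        simpa using hs0.mul_const t
      filter_upwards [self_mem_nhdsWithin, h1.eventually (Ioo_mem_nhds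
        (neg_lt_zero.mpr Real.pi_pos) Real.pi_pos)] with x hx hxt
      have hsx := hspos x hx
      have ht : t ∈ Set.Ioc (-Real.pi / s x) (Real.pi / s x) := by
        constructor
        · rw [div_lt_iff₀ hsx]; linarith [hxt.1]
        · rw [le_div_iff₀ hsx]; linarith [hxt.2]
      simp only [hF, Set.indicator_of_mem ht]
      rfl
  rw [integral_complex_ofReal, integral_gaussian] at key
  have e2 : Real.pi / (((m : ℝ) + 1) * (m + 2) / 2) = 2 * Real.pi / ((m + 1) * (m + 2)) := by
    field_simp
  rw [e2] at key
  refine key.congr' ?_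
  filter_upwards [self_mem_nhdsWithin] with x hx
  have hsx := hspos x hx
  simp only [hF]
  rw [MeasureTheory.integral_indicator measurableSet_Ioc, ← intervalIntegral.integral_of_le (by
    gcongr; linarith [Real.pi_pos]), intervalIntegral.integral_comp_mul_left _ hsx.ne',
    mul_div_cancel₀ _ hsx.ne', mul_div_cancel₀ _ hsx.ne', Complex.real_smul]
  simp only [hs, inv_div]

/-! ### Values of the zeta function -/

theorem ofReal_zetaDerivReal {x : ℝ} (hx : x ≠ 1) :
    ((zetaDerivReal x : ℝ) : ℂ) = deriv riemannZeta x := by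
  have h1 : HasDerivAt (fun t : ℝ => riemannZeta t) (deriv riemannZeta x) x :=
    (differentiableAt_riemannZeta (by exact_mod_cast hx)).hasDerivAt.comp_ofReal
  have h2 := (hasDerivAt_zetaReal x hx).ofReal_comp
  simp_rw [ofReal_zetaReal] at h2
  exact h2.unique h1

theorem zetaReal_add_two (m : ℕ) :
    zetaReal (m + 2) = ∑' n : ℕ, 1 / (n : ℝ) ^ (m + 2) := by
  have h := zeta_nat_eq_tsum_of_gt_one (k := m + 2) (by omega)
  have h2 : ((zetaReal (m + 2) : ℝ) : ℂ) = ((∑' n : ℕ, 1 / (n : ℝ) ^ (m + 2) : ℝ) : ℂ) := by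
    rw [ofReal_zetaReal]
    push_cast at h ⊢
    exact h
  exact_mod_cast h2

theorem succ_mul_leadCoeff (m : ℕ) : (m + 1) * leadCoeff m
    = ((2 : ℝ) ^ (m + 2) - 1) * Real.Gamma (m + 2) * zetaReal (m + 2) / 2 ^ (m + 1) := by
  have hs : Summable fun n : ℕ => 1 / (n : ℝ) ^ (m + 2) :=
    Real.summable_one_div_nat_pow.mpr (by omega)
  have h1 := tsum_even_add_odd (f := fun n : ℕ => 1 / (n : ℝ) ^ (m + 2))
    (hs.comp_injective fun a b h => by simpa using h)
    (hs.comp_injective fun a b h => by simpa using h)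
  have h2 : ∑' k : ℕ, 1 / ((2 * k : ℕ) : ℝ) ^ (m + 2)
      = 1 / 2 ^ (m + 2) * ∑' n : ℕ, 1 / (n : ℝ) ^ (m + 2) := by
    rw [← tsum_mul_left]
    refine tsum_congr fun k => ?_
    push_cast
    rw [mul_pow, one_div_mul_one_div]
  rw [h2, ← zetaReal_add_two] at h1
  have h3 : ∑' j : ℕ, 1 / (2 * (j : ℝ) + 1) ^ (m + 2)
      = zetaReal (m + 2) - 1 / 2 ^ (m + 2) * zetaReal (m + 2) := by
    push_cast at h1
    linarith
  have h4 : Real.Gamma (m + 2) = (m + 1) * m.factorial := by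
    have := Real.Gamma_nat_eq_factorial (m + 1)
    push_cast at this
    rw [show (m : ℝ) + 2 = m + 1 + 1 by ring, this, Nat.factorial_succ]
    push_cast; rfl
  rw [leadCoeff, h3, h4]
  field_simp
  ring

theorem zetaReal_neg_of_even {m : ℕ} (hm : Even m) (h2 : 2 ≤ m) : zetaReal (-m) = 0 := by
  obtain ⟨k, hk⟩ := hm
  obtain ⟨j, rfl⟩ : ∃ j, k = j + 1 := ⟨k - 1, by omega⟩
  have h := riemannZeta_neg_two_mul_nat_add_one j
  have e : (((-(m : ℝ)) : ℝ) : ℂ) = -2 * (j + 1) := by rw [hk]; push_cast; ring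
  rw [zetaReal, e, h, Complex.zero_re]

/-- The derivative of the zeta function at a negative even integer, from the functional equation:
there the cosine factor vanishes, so only its derivative contributes. -/
theorem zetaDerivReal_neg_of_even {m : ℕ} (hm : Even m) (h2 : 2 ≤ m) :
    zetaDerivReal (-m) = (-1 : ℝ) ^ (m / 2) * Real.Gamma ((m : ℝ) + 1) * zetaReal ((m : ℝ) + 1)
      / ((2 : ℝ) ^ (m + 1) * Real.pi ^ m) := by
  obtain ⟨k, hk⟩ := hm
  have hk2 : m / 2 = k := by omega
  have hπ : (Real.pi : ℂ) ≠ 0 := by exact_mod_cast Real.pi_ne_zero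
  set s₀ : ℂ := m + 1 with hs₀
  have hs₀re : s₀.re = m + 1 := by simp [hs₀]
  have hne : s₀ ≠ 1 := fun h => by
    rw [h] at hs₀re
    simp at hs₀re
    omega
  have hopen : {s : ℂ | 1 < s.re} ∈ nhds s₀ :=
    (isOpen_lt continuous_const Complex.continuous_re).mem_nhds (by
      simp only [Set.mem_ofPred_eq, hs₀re]
      have : (2 : ℝ) ≤ m := by exact_mod_cast h2
      linarith)
  have hneg : ∀ n : ℕ, s₀ ≠ -n := fun n h => by
    rw [h] at hs₀re
    simp at hs₀re
    linarith [n.cast_nonneg (α := ℝ), m.cast_nonneg (α := ℝ)]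
  -- The functional equation with the cosine split off.
  have ev : (fun s => riemannZeta (1 - s)) =ᶠ[nhds s₀] fun s =>
      (2 * (2 * Real.pi : ℂ) ^ (-s) * Complex.Gamma s * riemannZeta s)
        * Complex.cos (Real.pi * s / 2) := by
    filter_upwards [hopen] with s hs
    have hs' : 1 < s.re := hs
    rw [riemannZeta_one_sub (fun n h => by
      rw [h] at hs'; simp at hs'; linarith [n.cast_nonneg (α := ℝ)])
      (fun h => by rw [h] at hs'; simp at hs')]
    ring
  have h1s : (1 : ℂ) - s₀ = -m := by rw [hs₀]; ring
  have dL : HasDerivAt (fun s => riemannZeta (1 - s)) (-deriv riemannZeta (-m)) s₀ := by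
    have := (differentiableAt_riemannZeta (neg_natCast_ne_one m)).hasDerivAt
    rw [← h1s] at this ⊢
    exact this.comp_const_sub 1 s₀
  have dH : DifferentiableAt ℂ (fun s =>
      2 * (2 * Real.pi : ℂ) ^ (-s) * Complex.Gamma s * riemannZeta s) s₀ := by
    have d1 := Complex.differentiableAt_Gamma s₀ hneg
    have d2 := differentiableAt_riemannZeta hne
    have d3 : DifferentiableAt ℂ (fun s : ℂ => (2 * Real.pi : ℂ) ^ (-s)) s₀ :=
      differentiableAt_id.neg.const_cpow (Or.inl (by simp [hπ]))
    fun_prop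
  have dC : HasDerivAt (fun s : ℂ => Complex.cos (Real.pi * s / 2))
      (-Complex.sin (Real.pi * s₀ / 2) * (Real.pi / 2)) s₀ := by
    have : HasDerivAt (fun s : ℂ => Real.pi * s / 2) ((Real.pi : ℂ) / 2) s₀ := by
      simpa using! ((hasDerivAt_id s₀).const_mul (Real.pi : ℂ)).div_const 2
    exact this.ccos
  have harg : Real.pi * s₀ / 2 = ((Real.pi / 2 + k * Real.pi : ℝ) : ℂ) := by
    rw [hs₀, hk]; push_cast; ring
  have hcos : Complex.cos (Real.pi * s₀ / 2) = 0 := by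
    rw [harg, ← Complex.ofReal_cos, Real.cos_add_nat_mul_pi, Real.cos_pi_div_two]; simp
  have hsin : Complex.sin (Real.pi * s₀ / 2) = (-1) ^ k := by
    rw [harg, ← Complex.ofReal_sin, Real.sin_add_nat_mul_pi, Real.sin_pi_div_two]; simp
  have key := dL.unique ((dH.hasDerivAt.mul dC).congr_of_eventuallyEq ev)
  rw [hcos, hsin, mul_zero, zero_add] at key
  have hpow : (2 * Real.pi : ℂ) ^ (-s₀) = ((2 * Real.pi : ℂ) ^ (m + 1))⁻¹ := by
    rw [Complex.cpow_neg, hs₀, show (m + 1 : ℂ) = ((m + 1 : ℕ) : ℂ) by push_cast; rfl,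
      Complex.cpow_natCast]
  have hΓ : Complex.Gamma s₀ = ((Real.Gamma ((m : ℝ) + 1) : ℝ) : ℂ) := by
    rw [← Complex.Gamma_ofReal, hs₀]; push_cast; rfl
  have hζ : riemannZeta s₀ = ((zetaReal ((m : ℝ) + 1) : ℝ) : ℂ) := by
    rw [ofReal_zetaReal, hs₀]; push_cast; rfl
  rw [hpow, hΓ, hζ] at key
  have hm1 : (-(m : ℝ)) ≠ 1 := by linarith [m.cast_nonneg (α := ℝ)]
  have hD := ofReal_zetaDerivReal hm1
  push_cast at hD
  rw [← hD] at key
  have key2 : ((zetaDerivReal (-m) : ℝ) : ℂ) = (((-1 : ℝ) ^ (m / 2) * Real.Gamma ((m : ℝ) + 1)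
      * zetaReal ((m : ℝ) + 1) / ((2 : ℝ) ^ (m + 1) * Real.pi ^ m) : ℝ) : ℂ) := by
    rw [hk2]
    push_cast
    rw [neg_eq_iff_eq_neg] at key
    rw [key, mul_pow]
    field_simp
    ring
  exact_mod_cast key2

/-! ### The asymptotics of the coefficients -/

/-- The saddle point for the coefficient of index `n`. -/
noncomputable def saddlePoint (m n : ℕ) : ℝ :=
  ((m + 1) * leadCoeff m / n) ^ (1 / ((m : ℝ) + 2))

theorem saddlePoint_pos (m : ℕ) {n : ℕ} (hn : 0 < n) : 0 < saddlePoint m n := by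
  have := leadCoeff_pos m
  have : (0 : ℝ) < n := by exact_mod_cast hn
  exact Real.rpow_pos_of_pos (by positivity) _

theorem saddlePoint_pow (m n : ℕ) :
    saddlePoint m n ^ (m + 2) = (m + 1) * leadCoeff m / n := by
  have := leadCoeff_pos m
  have e : (1 / ((m : ℝ) + 2)) = ((m + 2 : ℕ) : ℝ)⁻¹ := by push_cast; rw [one_div]
  rw [saddlePoint, e, Real.rpow_inv_natCast_pow (by positivity) (by omega)]

theorem tendsto_saddlePoint (m : ℕ) :
    Tendsto (saddlePoint m) atTop (nhdsWithin 0 (Set.Ioi 0)) := by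
  rw [tendsto_nhdsWithin_iff]
  constructor
  · have h : Tendsto (fun n : ℕ => (m + 1) * leadCoeff m / n) atTop (nhds 0) :=
      tendsto_const_div_atTop_nhds_zero_nat _
    have hp : (0 : ℝ) < 1 / ((m : ℝ) + 2) := by positivity
    have := (Real.continuousAt_rpow_const 0 (1 / ((m : ℝ) + 2)) (Or.inr hp.le)).tendsto.comp h
    rwa [Real.zero_rpow hp.ne'] at this
  · filter_upwards [eventually_gt_atTop 0] with n hn using saddlePoint_pos m hn

/-- Cauchy's formula with the integral over the vertical line through the saddle point. -/
theorem ratioCoeff_eq_integral_saddleIntegrand (m : ℕ) {n : ℕ} (hn : 0 < n) {x : ℝ}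
    (hx : 0 < x) (hxn : x ^ (m + 2) = (m + 1) * leadCoeff m / n) :
    ((2 * Real.pi : ℝ) : ℂ) * ratioCoeff m n = Complex.exp (logGen m x + n * x)
      * ∫ y in (-Real.pi)..Real.pi, saddleIntegrand m x y := by
  have hn' : (n : ℝ) ≠ 0 := by exact_mod_cast hn.ne'
  have hN : (n : ℝ) * x ^ (m + 2) = (m + 1) * leadCoeff m := by rw [hxn]; field_simp
  rw [← integral_exp_logGen m n hx, ← intervalIntegral.integral_const_mul]
  refine intervalIntegral.integral_congr fun y _ => ?_
  have e : (m + 1) * (leadCoeff m / x ^ (m + 1)) * (y / x) = n * y := by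
    rw [show (m + 1) * (leadCoeff m / x ^ (m + 1)) * (y / x)
      = (m + 1) * leadCoeff m * y / x ^ (m + 2) by field_simp; ring, ← hN]
    field_simp
  simp only [saddleIntegrand]
  rw [e, ← Complex.exp_add, ← Complex.exp_add]
  congr 1
  push_cast
  ring

/-- The predicted size of the coefficient in terms of the saddle point. -/
theorem predicted_eq (m : ℕ) {n : ℕ} (hn : 0 < n) {x : ℝ} (hx : 0 < x)
    (hxn : x ^ (m + 2) = (m + 1) * leadCoeff m / n) (r d : ℝ) :
    (((2 : ℝ) ^ (m + 2) - 1) * Real.Gamma ((m : ℝ) + 2) * zetaReal ((m : ℝ) + 2)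
              / ((2 : ℝ) ^ (2 * m + 3) * (n : ℝ)))
            ^ ((1 - 2 * r) / (2 * (m : ℝ) + 4))
          * Real.exp
              (((m : ℝ) + 2) / ((m : ℝ) + 1)
                  * (((2 : ℝ) ^ (m + 2) - 1) * (n : ℝ) ^ (m + 1) * Real.Gamma ((m : ℝ) + 2)
                        * zetaReal ((m : ℝ) + 2) / (2 : ℝ) ^ (m + 1))
                      ^ (1 / ((m : ℝ) + 2))
                + d)
          / Real.sqrt (((m : ℝ) + 2) * Real.pi * (n : ℝ))
      = Real.exp (leadCoeff m / x ^ (m + 1) + n * x) * Real.exp (-r * Real.log (x / 2))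
        * (x / Real.sqrt (leadCoeff m / x ^ (m + 1))) / (2 * Real.pi)
        * (Real.exp d * Real.sqrt (2 * Real.pi / ((m + 1) * (m + 2)))) := by
  have hn0 : (0 : ℝ) < n := by exact_mod_cast hn
  have hA := leadCoeff_pos m
  have hB := succ_mul_leadCoeff m
  have hN : (m + 1) * leadCoeff m = n * x ^ (m + 2) := by rw [hxn]; field_simp
  have hL : leadCoeff m / x ^ (m + 1) = n * x / (m + 1) := by
    rw [div_eq_div_iff (by positivity) (by positivity), mul_comm, hN]; ring
  have b1 : ((2 : ℝ) ^ (m + 2) - 1) * Real.Gamma ((m : ℝ) + 2) * zetaReal ((m : ℝ) + 2)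
      / ((2 : ℝ) ^ (2 * m + 3) * (n : ℝ)) = (x / 2) ^ (m + 2) := by
    rw [div_pow, hxn, hB]
    rw [show 2 * m + 3 = (m + 1) + (m + 2) by ring, pow_add (2 : ℝ) (m + 1)]
    field_simp
  have b2 : ((2 : ℝ) ^ (m + 2) - 1) * (n : ℝ) ^ (m + 1) * Real.Gamma ((m : ℝ) + 2)
      * zetaReal ((m : ℝ) + 2) / (2 : ℝ) ^ (m + 1) = (n * x) ^ (m + 2) := by
    rw [mul_pow, pow_succ (n : ℝ) (m + 1), mul_assoc ((n : ℝ) ^ (m + 1)), ← hN, hB]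
    ring
  have p1 : ((x / 2) ^ (m + 2)) ^ ((1 - 2 * r) / (2 * (m : ℝ) + 4))
      = Real.sqrt (x / 2) * Real.exp (-r * Real.log (x / 2)) := by
    rw [← Real.rpow_natCast, ← Real.rpow_mul (by positivity),
      show (((m + 2 : ℕ) : ℝ) * ((1 - 2 * r) / (2 * (m : ℝ) + 4))) = 1 / 2 + -r by
        push_cast; field_simp; ring,
      Real.rpow_add (by positivity), ← Real.sqrt_eq_rpow, Real.rpow_def_of_pos (by positivity) (-r),
      mul_comm (Real.log _)]
  have p2 : ((n * x) ^ (m + 2)) ^ (1 / ((m : ℝ) + 2)) = n * x := by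
    rw [show (1 / ((m : ℝ) + 2)) = ((m + 2 : ℕ) : ℝ)⁻¹ by push_cast; rw [one_div],
      Real.pow_rpow_inv_natCast (by positivity) (by omega)]
  rw [b1, b2, p1, p2, hL, Real.exp_add (_ * _) d,
    show ((m : ℝ) + 2) / (m + 1) * (n * x) = n * x / (m + 1) + n * x by field_simp; ring]
  -- The remaining algebraic factors agree: both products of square roots reduce to `w`.
  set w := Real.sqrt (n / (2 * (m + 1))) with hw
  have hw0 : 0 < w := Real.sqrt_pos.mpr (by positivity)
  have s1 : Real.sqrt (((m : ℝ) + 2) * Real.pi * n) * Real.sqrt (2 * Real.pi / ((m + 1) * (m + 2)))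
      = 2 * Real.pi * w := by
    rw [← Real.sqrt_mul (by positivity), show ((m : ℝ) + 2) * Real.pi * n *
      (2 * Real.pi / ((m + 1) * (m + 2))) = (2 * Real.pi) ^ 2 * (n / (2 * (m + 1))) by field_simp,
      Real.sqrt_mul (by positivity), Real.sqrt_sq (by positivity)]
  have s2 : Real.sqrt (x / 2) * Real.sqrt (n * x / (m + 1)) = x * w := by
    rw [← Real.sqrt_mul (by positivity), show x / 2 * (n * x / (m + 1))
      = x ^ 2 * (n / (2 * (m + 1))) by field_simp, Real.sqrt_mul (by positivity),
      Real.sqrt_sq hx.le]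
  have q1 : 0 < Real.sqrt (((m : ℝ) + 2) * Real.pi * n) := Real.sqrt_pos.mpr (by positivity)
  have q2 : 0 < Real.sqrt (n * x / (m + 1)) := Real.sqrt_pos.mpr (by positivity)
  have s3 : Real.sqrt (x / 2) / Real.sqrt (((m : ℝ) + 2) * Real.pi * n)
      = x / Real.sqrt (n * x / (m + 1)) / (2 * Real.pi)
        * Real.sqrt (2 * Real.pi / ((m + 1) * (m + 2))) := by
    rw [div_div, div_mul_eq_mul_div, div_eq_div_iff q1.ne' (by positivity)]
    linear_combination 2 * Real.pi * s2 - x * s1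
  linear_combination Real.exp (-r * Real.log (x / 2)) * Real.exp (n * x / (m + 1) + n * x)
    * Real.exp d * s3

/-- The coefficient is its main term times the normalised Laplace integral and the exponential of
the error in the expansion on the real axis, evaluated at the saddle point. -/
theorem ratioCoeff_isEquivalent (m : ℕ) :
    (fun n : ℕ => ratioCoeff m n) ~[atTop]
      (fun n : ℕ =>
        (((2 : ℝ) ^ (m + 2) - 1) * Real.Gamma ((m : ℝ) + 2) * zetaReal ((m : ℝ) + 2)
              / ((2 : ℝ) ^ (2 * m + 3) * (n : ℝ)))
            ^ ((1 - 2 * zetaReal (-(m : ℝ))) / (2 * (m : ℝ) + 4))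
          * Real.exp
              (((m : ℝ) + 2) / ((m : ℝ) + 1)
                  * (((2 : ℝ) ^ (m + 2) - 1) * (n : ℝ) ^ (m + 1) * Real.Gamma ((m : ℝ) + 2)
                        * zetaReal ((m : ℝ) + 2) / (2 : ℝ) ^ (m + 1))
                      ^ (1 / ((m : ℝ) + 2))
                + zetaDerivReal (-(m : ℝ)))
          / Real.sqrt (((m : ℝ) + 2) * Real.pi * (n : ℝ))) := by
  have hA := leadCoeff_pos m
  set r := zetaReal (-(m : ℝ)) with hr
  set d := zetaDerivReal (-(m : ℝ)) with hd
  set σ := Real.sqrt (2 * Real.pi / ((m + 1) * (m + 2))) with hσ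
  have hσ0 : 0 < σ := Real.sqrt_pos.mpr (by positivity)
  have hr' : riemannZeta (-m) = (r : ℂ) := by rw [hr, ofReal_zetaReal]; push_cast; rfl
  have hd' : deriv riemannZeta (-m) = (d : ℂ) := by
    rw [hd, ofReal_zetaDerivReal (by linarith [m.cast_nonneg (α := ℝ)])]; push_cast; rfl
  have t1 := (tendsto_logRemainder m).comp (tendsto_saddlePoint m)
  have t2 := (tendsto_integral_saddleIntegrand m).comp (tendsto_saddlePoint m)
  rw [hd', hr'] at t1
  have t3 := ((((Complex.continuous_exp.tendsto _).comp t1).mul t2).const_mul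
    (((Real.exp d * σ)⁻¹ : ℝ) : ℂ))
  have t4 := (Complex.continuous_re.tendsto _).comp t3
  have e1 : ((((Real.exp d * σ)⁻¹ : ℝ) : ℂ) * (Complex.exp d * (σ : ℂ))).re = 1 := by
    rw [← Complex.ofReal_exp, ← Complex.ofReal_mul, ← Complex.ofReal_mul, Complex.ofReal_re,
      inv_mul_cancel₀ (by positivity)]
  rw [e1] at t4
  -- The ratio is the real part of a complex expression tending to `1`, the coefficients and the
  -- main term being real.
  refine isEquivalent_iff_exists_eq_mul.mpr ⟨_, t4, ?_⟩
  filter_upwards [eventually_gt_atTop 0] with n hn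
  have hx := saddlePoint_pos m hn
  have hxn := saddlePoint_pow m n
  simp only [Pi.mul_apply, Function.comp_apply]
  rw [predicted_eq m hn hx hxn r d]
  set x := saddlePoint m n with hxdef
  have hL : 0 < Real.sqrt (leadCoeff m / x ^ (m + 1)) := Real.sqrt_pos.mpr (by positivity)
  have key := ratioCoeff_eq_integral_saddleIntegrand m hn hx hxn
  set J : ℂ := ∫ y in (-Real.pi)..Real.pi, saddleIntegrand m x y with hJ
  have hlog : logGen m x = logRemainder m x + ((leadCoeff m / x ^ (m + 1) : ℝ) : ℂ) := by
    rw [logRemainder]; push_cast; ring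
  have hexp : Complex.exp (logGen m x + n * x)
      = ((Real.exp (leadCoeff m / x ^ (m + 1) + n * x) * Real.exp (-r * Real.log (x / 2)) : ℝ) : ℂ)
        * Complex.exp (logRemainder m x + r * ((Real.log (x / 2) : ℝ) : ℂ)) := by
    rw [hlog, ← Real.exp_add, Complex.ofReal_exp, ← Complex.exp_add]
    congr 1
    push_cast
    ring
  rw [hexp] at key
  have h2 : (ratioCoeff m n : ℂ) = ((Real.exp (leadCoeff m / x ^ (m + 1) + n * x)
        * Real.exp (-r * Real.log (x / 2))
        * (x / Real.sqrt (leadCoeff m / x ^ (m + 1))) / (2 * Real.pi)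
        * (Real.exp d * σ) : ℝ) : ℂ) * ((((Real.exp d * σ)⁻¹ : ℝ) : ℂ)
        * (Complex.exp (logRemainder m x + r * ((Real.log (x / 2) : ℝ) : ℂ))
          * (((Real.sqrt (leadCoeff m / x ^ (m + 1)) / x : ℝ) : ℂ) * J))) := by
    have hpi : ((2 * Real.pi : ℝ) : ℂ) ≠ 0 := by
      exact_mod_cast (by positivity : (2 * Real.pi : ℝ) ≠ 0)
    have hreal : 2 * Real.pi * (Real.exp (leadCoeff m / x ^ (m + 1) + n * x)
        * Real.exp (-r * Real.log (x / 2))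
        * (x / Real.sqrt (leadCoeff m / x ^ (m + 1))) / (2 * Real.pi)
        * (Real.exp d * σ)) * (Real.exp d * σ)⁻¹ * (Real.sqrt (leadCoeff m / x ^ (m + 1)) / x)
        = Real.exp (leadCoeff m / x ^ (m + 1) + n * x) * Real.exp (-r * Real.log (x / 2)) := by
      have := Real.pi_pos
      have := Real.exp_pos d
      field_simp
    rw [← hreal] at key
    refine mul_left_cancel₀ hpi (key.trans ?_)
    generalize (Real.exp (leadCoeff m / x ^ (m + 1) + n * x)
        * Real.exp (-r * Real.log (x / 2))
        * (x / Real.sqrt (leadCoeff m / x ^ (m + 1))) / (2 * Real.pi)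
        * (Real.exp d * σ)) = a
    generalize (Real.exp d * σ)⁻¹ = b
    generalize Real.sqrt (leadCoeff m / x ^ (m + 1)) / x = c
    push_cast
    ring
  have h3 := congrArg Complex.re h2
  rw [Complex.ofReal_re, Complex.re_ofReal_mul] at h3
  rw [h3, mul_comm]

theorem mainTheorem11 (m : ℕ) :
    (fun n : ℕ => ratioCoeff m n) ~[atTop]
      (fun n : ℕ =>
        (((2 : ℝ) ^ (m + 2) - 1) * Real.Gamma ((m : ℝ) + 2) * zetaReal ((m : ℝ) + 2)
              / ((2 : ℝ) ^ (2 * m + 3) * (n : ℝ)))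
            ^ ((1 - 2 * zetaReal (-(m : ℝ))) / (2 * (m : ℝ) + 4))
          * Real.exp
              (((m : ℝ) + 2) / ((m : ℝ) + 1)
                  * (((2 : ℝ) ^ (m + 2) - 1) * (n : ℝ) ^ (m + 1) * Real.Gamma ((m : ℝ) + 2)
                        * zetaReal ((m : ℝ) + 2) / (2 : ℝ) ^ (m + 1))
                      ^ (1 / ((m : ℝ) + 2))
                + zetaDerivReal (-(m : ℝ)))
          / Real.sqrt (((m : ℝ) + 2) * Real.pi * (n : ℝ)))
    ∧ (Even m → 2 ≤ m →
      (fun n : ℕ => ratioCoeff m n) ~[atTop]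
        (fun n : ℕ =>
          (((2 : ℝ) ^ (m + 2) - 1) * Real.Gamma ((m : ℝ) + 2) * zetaReal ((m : ℝ) + 2)
                / ((2 : ℝ) ^ (2 * m + 3) * (n : ℝ)))
              ^ (1 / (2 * (m : ℝ) + 4))
            * Real.exp
                (((m : ℝ) + 2) / ((m : ℝ) + 1)
                    * (((2 : ℝ) ^ (m + 2) - 1) * (n : ℝ) ^ (m + 1) * Real.Gamma ((m : ℝ) + 2)
                          * zetaReal ((m : ℝ) + 2) / (2 : ℝ) ^ (m + 1))
                        ^ (1 / ((m : ℝ) + 2))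
                  + (-1 : ℝ) ^ (m / 2) * Real.Gamma ((m : ℝ) + 1) * zetaReal ((m : ℝ) + 1)
                      / ((2 : ℝ) ^ (m + 1) * Real.pi ^ m))
            / Real.sqrt (((m : ℝ) + 2) * Real.pi * (n : ℝ)))) := by
  refine ⟨ratioCoeff_isEquivalent m, fun hm h2 => ?_⟩
  have h := ratioCoeff_isEquivalent m
  rw [zetaReal_neg_of_even hm h2, zetaDerivReal_neg_of_even hm h2, mul_zero, sub_zero] at h
  exact h
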